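/- **Theorem (exact-$Q$ Wasserstein proximal policy gradient, WPPG, for entropy-regularized RL).** Consider a discounted MDP with a measurable state space $\mathcal S$, a bounded measurable action space $\mathcal A\subset\mathbb R^d$ of positive Lebesgue measure, a transition kernel $P$, a measurable reward $R_{\min}\le r\le R_{\max}$ on $\mathcal S\times\mathcal A$, and a discount factor $\gamma\in(0,1)$. Let $\tau>0$. A policy is a Markov kernel $s\mapsto\pi(\cdot\mid s)\in\mathcal P(\mathcal A)$. For a probability measure $q$ on $\mathcal A$ put $\mathcal H(q)=\int q\log q\,da\in(-\infty,\infty]$ (equal to $+\infty$ if $q$ has no Lebesgue density), and write $\mathcal H^\pi(s)=\mathcal H(\pi(\cdot\mid s))$. Set $$V_\tau^\pi(s)=\mathbb E^\pi\Big[\sum_{t\ge0}\gamma^t\big(r(s_t,a_t)-\tau\mathcal H^\pi(s_t)\big)\,\Big|\,s_0=s\Big]\in[-\infty,\infty),\qquad Q_\tau^\pi(s,a)=r(s,a)+\gamma\,\mathbb E\big[V_\tau^\pi(s')\mid s,a\big].$$ Let $\pi^\star$ be an optimal policy, i.e. $V_\tau^{\pi^\star}(s)\ge V_\tau^\pi(s)$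 for all $s$ and all policies $\pi$, and let $\nu^\star$ be a stationary distribution of the state process under $\pi^\star$. Put $$J(\pi)=\mathbb E_{s\sim\nu^\star}[V_\tau^\pi(s)],\qquad \mathcal D(\pi,\pi^\star)=\mathbb E_{s\sim\nu^\star}\big[\tfrac12 W_2^2(\pi(\cdot\mid s),\pi^\star(\cdot\mid s))\big].$$ Let $\lambda>0$, $\eta=\frac1{\gamma\lambda\tau}$, and let $(\pi_k)_{k\ge0}$ be policies with, for every $k\ge 0$ and every state $s$, $$\pi_{k+1}(\cdot\mid s)\in\arg\max_{q\in\mathcal P(\mathcal A)}\Big\{\int Q_\tau^{\pi_k}(s,a)\,q(da)-\frac1{2\eta}W_2^2\big(q,\pi_k(\cdot\mid s)\big)-\tau\mathcal H(q)\Big\}.$$ Assume that every $\mu=\pi_k(\cdot\mid s)$, $k\ge0$, $s\in\mathcal S$, satisfies the inequality $T_2(\lambda)$: $W_2^2(\nu,\mu)\le\frac2\lambda\,\mathrm{KL}(\nu\,\|\,\mu)$ for every probability measure $\nu$ on $\mathbb R^d$ with finite second moment. Let $$L_k=J(\pi^\star)-J(\pi_k)+\lambda\tau\,\mathcal D(\pi_k,\pi^\star).$$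 Then $L_{k+1}\le\gamma L_k$ for every $k\ge0$, and hence $L_k\le\gamma^kL_0$. Consequently, if $L_0<\infty$, then for every $\varepsilon>0$ one has $L_k\le\varepsilon$ for all integers $k\ge0$ with $k\ge\frac1{1-\gamma}\log\frac{L_0}{\varepsilon}$ (for all $k\ge0$ if $L_0=0$), so the iteration complexity is $O\big(\frac1{1-\gamma}\log\frac{L_0}{\varepsilon}\big)$. -/

import Mathlib

open MeasureTheory ProbabilityTheory Set
open scoped ENNReal

noncomputable section

/-- Euclidean space `ℝᵈ`, in which the action space lives. -/
abbrev ActionSpace (d : ℕ) : Type := EuclideanSpace ℝ (Fin d)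

/-- The extended-valued integral `∫ f⁺ dμ - ∫ f⁻ dμ` of an extended-real function. (Below it is
only used for functions whose positive part or whose negative part has a finite integral.) -/
def extIntegral {α : Type*} [MeasurableSpace α] (μ : Measure α) (f : α → EReal) : EReal :=
  ((∫⁻ x, (f x).toENNReal ∂μ : ℝ≥0∞) : EReal) - ((∫⁻ x, (-f x).toENNReal ∂μ : ℝ≥0∞) : EReal)

open Classical in
/-- Negative differential entropy `∫ p log p da` of a measure with Lebesgue density `p`;
it is `+∞` for a measure that has no density. -/
def negEntropy {d : ℕ} (μ : Measure (ActionSpace d)) : EReal :=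
  if μ ≪ volume then
    extIntegral volume fun a =>
      (((μ.rnDeriv volume a).toReal * Real.log (μ.rnDeriv volume a).toReal : ℝ) : EReal)
  else ⊤

/-- `c` is a coupling of `μ` and `ν`. -/
def IsCoupling {d : ℕ} (μ ν : Measure (ActionSpace d))
    (c : Measure (ActionSpace d × ActionSpace d)) : Prop :=
  c.map Prod.fst = μ ∧ c.map Prod.snd = ν

/-- The squared 2-Wasserstein distance `W₂²(μ, ν) = inf_c ∫ ‖x - y‖² dc(x, y)`,
the infimum being over all couplings `c` of `μ` and `ν`. -/
def W2sq {d : ℕ} (μ ν : Measure (ActionSpace d)) : ℝ≥0∞ :=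
  ⨅ (c : Measure (ActionSpace d × ActionSpace d)) (_ : IsCoupling μ ν c),
    ∫⁻ z, ENNReal.ofReal (‖z.1 - z.2‖ ^ 2) ∂c

/-- Membership in `𝒫₂(ℝᵈ)`: probability measures with finite second moment. -/
structure IsP2 {d : ℕ} (μ : Measure (ActionSpace d)) : Prop where
  isProbabilityMeasure : IsProbabilityMeasure μ
  secondMoment : ∫⁻ x, ENNReal.ofReal (‖x‖ ^ 2) ∂μ < ⊤

/-- The `T₂(lam)` transportation-information inequality for `μ ∈ 𝒫₂(ℝᵈ)`. -/
structure SatisfiesT2 {d : ℕ} (lam : ℝ) (μ : Measure (ActionSpace d)) : Prop where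
  isP2 : IsP2 μ
  le_kl : ∀ ν : Measure (ActionSpace d), IsP2 ν →
    W2sq ν μ ≤ ENNReal.ofReal (2 / lam) * InformationTheory.klDiv ν μ

/-- An infinite-horizon discounted Markov decision process with state space `S` and action space
`actions ⊆ ℝᵈ`. Rewards and transitions outside `actions` are never used. -/
structure MDP (S : Type*) [MeasurableSpace S] (d : ℕ) where
  /-- the action space -/
  actions : Set (ActionSpace d)
  measurableSet_actions : MeasurableSet actions
  /-- the transition kernel -/
  trans : Kernel (S × ActionSpace d) S
  isMarkovKernel_trans : IsMarkovKernel trans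
  /-- the reward function -/
  reward : S → ActionSpace d → ℝ
  measurable_reward : Measurable (Function.uncurry reward)
  /-- the discount factor -/
  disc : ℝ
  disc_pos : 0 < disc
  disc_lt_one : disc < 1

namespace MDP

variable {S : Type*} [MeasurableSpace S] {d : ℕ}

/-- `q ∈ 𝒫(𝒜)`: a probability measure carried by the action space. -/
structure IsActionLaw (M : MDP S d) (q : Measure (ActionSpace d)) : Prop where
  isProbabilityMeasure : IsProbabilityMeasure q
  compl_null : q M.actionsᶜ = 0

/-- A policy: a (measurable) Markov kernel `s ↦ π(· | s) ∈ 𝒫(𝒜)`. -/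
def IsPolicy (M : MDP S d) (π : Kernel S (ActionSpace d)) : Prop :=
  ∀ s, M.IsActionLaw (π s)

/-- One step of the state process under `π`: draw `a ∼ π(· | s)`, then `s' ∼ P(· | s, a)`. -/
def stepKernel (M : MDP S d) (π : Kernel S (ActionSpace d)) : Kernel S S :=
  M.trans ∘ₖ (Kernel.id ×ₖ π)

/-- The law of `s_t` under `π`, given `s_0`. -/
def stateKernel (M : MDP S d) (π : Kernel S (ActionSpace d)) : ℕ → Kernel S S
  | 0 => Kernel.id
  | t + 1 => M.stepKernel π ∘ₖ M.stateKernel π t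

/-- The discounted occupation measure `∑ₜ γᵗ · Law(s_t, a_t | s_0 = s)` under `π`. -/
def occupation (M : MDP S d) (π : Kernel S (ActionSpace d)) (s : S) :
    Measure (S × ActionSpace d) :=
  Measure.sum fun t : ℕ => ENNReal.ofReal (M.disc ^ t) • (M.stateKernel π t s ⊗ₘ π)

/-- The entropy-regularized value
`V_τ^π(s) = E^π[∑ₜ γᵗ (r(s_t, a_t) - τ H^π(s_t)) | s_0 = s]`, with values in `[-∞, ∞]`,
where `H^π(s)` is the negative entropy of `π(· | s)`. -/
def value (M : MDP S d) (τ : ℝ) (π : Kernel S (ActionSpace d)) (s : S) : EReal :=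
  extIntegral (M.occupation π s) fun x =>
    (M.reward x.1 x.2 : EReal) - (τ : EReal) * negEntropy (π x.1)

/-- The soft action value `Q_τ^π(s, a) = r(s, a) + γ E[V_τ^π(s') | s, a]`. -/
def softQ (M : MDP S d) (τ : ℝ) (π : Kernel S (ActionSpace d)) (s : S) (a : ActionSpace d) :
    EReal :=
  (M.reward s a : EReal) + (M.disc : EReal) * extIntegral (M.trans (s, a)) (M.value τ π)

/-- The objective of the proximal step at the state `s`:
`⟨Q_τ^π(s, ·), q⟩ - W₂²(q, π(· | s)) / (2η) - τ H(q)`. -/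
def proxObjective (M : MDP S d) (τ η : ℝ) (π : Kernel S (ActionSpace d)) (s : S)
    (q : Measure (ActionSpace d)) : EReal :=
  extIntegral q (M.softQ τ π s)
    - ((1 / (2 * η) : ℝ) : EReal) * ((W2sq q (π s) : ℝ≥0∞) : EReal)
    - (τ : EReal) * negEntropy q

/-- `π 0, π 1, …` are iterates of the Wasserstein proximal policy gradient method with step
size `η`: at every state, `π (k + 1)` maximizes the proximal objective of `π k` over `𝒫(𝒜)`. -/
structure IsWPPG (M : MDP S d) (τ η : ℝ) (π : ℕ → Kernel S (ActionSpace d)) : Prop where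
  isPolicy : ∀ k, M.IsPolicy (π k)
  isMax : ∀ k s, IsMaxOn (M.proxObjective τ η (π k) s) {q | M.IsActionLaw q} (π (k + 1) s)

/-- `π` is an optimal policy: it dominates every policy at every state. -/
structure IsOptimal (M : MDP S d) (τ : ℝ) (π : Kernel S (ActionSpace d)) : Prop where
  isPolicy : M.IsPolicy π
  le_value : ∀ π' : Kernel S (ActionSpace d), M.IsPolicy π' → ∀ s,
    M.value τ π' s ≤ M.value τ π s

/-- `J(π) = E_{s ∼ ν}[V_τ^π(s)]`. -/
def perf (M : MDP S d) (τ : ℝ) (ν : Measure S) (π : Kernel S (ActionSpace d)) : EReal :=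
  extIntegral ν (M.value τ π)

end MDP

/-- `𝒟(π, π') = E_{s ∼ ν}[½ W₂²(π(· | s), π'(· | s))]`. -/
def policyDist {S : Type*} [MeasurableSpace S] {d : ℕ} (ν : Measure S)
    (π π' : Kernel S (ActionSpace d)) : ℝ≥0∞ :=
  ∫⁻ s, 2⁻¹ * W2sq (π s) (π' s) ∂ν

/-- The Lyapunov quantity `J(π⋆) - J(π) + lam τ 𝒟(π, π⋆)`. -/
def MDP.lyapunov {S : Type*} [MeasurableSpace S] {d : ℕ} (M : MDP S d) (τ lam : ℝ)
    (ν : Measure S) (πstar π : Kernel S (ActionSpace d)) : EReal :=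
  M.perf τ ν πstar - M.perf τ ν π
    + ((lam * τ : ℝ) : EReal) * ((policyDist ν π πstar : ℝ≥0∞) : EReal)

end

/-! Every value is rewritten as a fixed real constant minus a cost in `[0, ∞]`: the discounted sum
of the reward deficit `R - r` plus `τ` times the relative entropy of the policy with respect to
Lebesgue measure `m` on the actions. Maximization becomes minimization of nonnegative extended
quantities, so infinite values need no separate integrability theory.

Write `C_π` for the cost, `c_π` for its one-step part, `P_π` for the step kernel and `T_ρ C = c_ρ +
γ P_ρ C`. The proximal step minimizes `Ψ + τ KL(· ‖ m)`, where `Ψ` (expected action cost plus the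
transport penalty) is convex along mixtures. Strong convexity of relative entropy gives, for the
minimizer `p` and any competitor `q`, `Ψ p + τ KL(p ‖ m) + τ KL(q ‖ p) ≤ Ψ q + τ KL(q ‖ m)`
(`add_klDiv_le_of_le_mixture`, `proximal_three_point`). No regularity of an optimal transport
problem enters: only mixtures of couplings and Fatou's lemma.

Let `π'` be the step from `π`. The competitor `π` has zero transport penalty, so `T_π' C_π ≤ C_π`,
and iterating yields `C_π' ≤ T_π' C_π`. The competitor `π⋆` leaves `τ KL(π⋆ ‖ π')` on the left,
which `T₂` bounds below by `λτ · ½ W₂²(π', π⋆)`; on the right the step size turns the penalty into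
`γ λτ · ½ W₂²(π, π⋆)`. Together, pointwise in the state (`costToGo_add_W2sq_le`), `C_π' + λτ · ½
W₂²(π', π⋆) ≤ c_π⋆ + γ P_π⋆ C_π + γ λτ · ½ W₂²(π, π⋆)`.

Integrating against the stationary law replaces `P_π⋆ C_π` by `C_π` and `c_π⋆` by `(1 - γ) C_π⋆`.
Subtracting `∫ C_π⋆`, finite by comparison with the uniform policy, gives the contraction. -/

open InformationTheory Filter Topology

/-! ### Convexity defect of the entropy function. -/

/-- The defect of convexity of `klFun` between `x` and `y`, measured through the chord of
slope parameter `t`. As `t → 0` it tends to the Bregman divergence of `klFun`. -/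
noncomputable def klGap (t x y : ℝ) : ℝ :=
  klFun y - klFun x - t⁻¹ * (klFun (x + t * (y - x)) - klFun x)

lemma measurable_klGap (t : ℝ) : Measurable fun p : ℝ × ℝ => klGap t p.1 p.2 := by
  unfold klGap
  have := measurable_klFun
  fun_prop

lemma add_mul_klGap {t : ℝ} (ht : t ≠ 0) (x y : ℝ) :
    (1 - t) * klFun x + t * klFun y = klFun ((1 - t) * x + t * y) + t * klGap t x y := by
  have : x + t * (y - x) = (1 - t) * x + t * y := by ring
  rw [klGap, this]
  field_simp
  ring

lemma klGap_nonneg {t x y : ℝ} (ht0 : 0 < t) (ht1 : t ≤ 1) (hx : 0 ≤ x) (hy : 0 ≤ y) :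
    0 ≤ klGap t x y := by
  have h := convexOn_klFun.2 hx hy (sub_nonneg.2 ht1) ht0.le (by ring)
  have h' := add_mul_klGap ht0.ne' x y
  simp only [smul_eq_mul] at h
  exact nonneg_of_mul_nonneg_right (by linarith) ht0

/-- The difference quotient tends to the derivative, and `klFun' = log`. If `x`, `y` are the
densities of `μ`, `ν` with respect to `m`, the limit is the integrand of `KL(ν ‖ μ)` expressed
against `m`. -/
lemma tendsto_klGap {x y : ℝ} (hx : 0 < x) :
    Tendsto (fun t => klGap t x y) (𝓝[>] 0) (𝓝 (x * klFun (y / x))) := by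
  have h1 : HasDerivAt (fun t : ℝ => klFun (x + t * (y - x))) (Real.log x * (y - x)) 0 := by
    have h2 : HasDerivAt (fun t : ℝ => x + t * (y - x)) (y - x) 0 := by
      simpa using ((hasDerivAt_id (0 : ℝ)).mul_const (y - x)).const_add x
    have h3 : HasDerivAt klFun (Real.log x) (x + 0 * (y - x)) := by
      simpa using hasDerivAt_klFun hx.ne'
    exact h3.comp (0 : ℝ) h2
  have h2 := (h1.tendsto_slope_zero_right).const_sub (klFun y - klFun x)
  have h3 : klFun y - klFun x - Real.log x * (y - x) = x * klFun (y / x) := by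
    rcases eq_or_ne y 0 with rfl | hy
    · simp [klFun]; ring
    · rw [klFun, klFun, klFun, Real.log_div hy hx.ne']
      field_simp
      ring
  rw [h3] at h2
  simpa [klGap] using h2

/-- The slope of `klFun` at `0` is `-∞`. A bounded integrated gap will therefore force `ν` to vanish
wherever `μ` does. -/
lemma tendsto_klGap_zero {y : ℝ} (hy : 0 < y) :
    Tendsto (fun t => klGap t 0 y) (𝓝[>] 0) atTop := by
  have h1 : Tendsto (fun t : ℝ => klFun y - 1 + y - y * Real.log (t * y)) (𝓝[>] 0) atTop := by
    have h2 : Tendsto (fun t : ℝ => t * y) (𝓝[>] 0) (𝓝[>] 0) := by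
      refine tendsto_nhdsWithin_iff.2 ⟨?_, ?_⟩
      · have : Tendsto (fun t : ℝ => t * y) (𝓝 0) (𝓝 (0 * y)) := by
          exact (continuous_id.mul continuous_const).tendsto 0
        simpa using this.mono_left nhdsWithin_le_nhds
      · filter_upwards [self_mem_nhdsWithin] with t ht using mul_pos ht hy
    have h3 := (Real.tendsto_log_nhdsGT_zero.comp h2).const_mul_atBot hy
    have h4 := tendsto_atTop_add_const_left _ (klFun y - 1 + y) (tendsto_neg_atBot_atTop.comp h3)
    refine h4.congr fun t => ?_
    simp [sub_eq_add_neg]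
  refine h1.congr' ?_
  filter_upwards [self_mem_nhdsWithin] with t ht
  have ht : t ≠ 0 := (show (0 : ℝ) < t from ht).ne'
  simp only [klGap, klFun]
  field_simp
  simp
  ring_nf

/-! ### Mixtures and strong convexity of relative entropy. -/

section Measures

variable {X : Type*} [MeasurableSpace X]

/-- The mixture `(1 - t) μ + t ν`. -/
noncomputable def mixture (t : ℝ) (μ ν : Measure X) : Measure X :=
  ENNReal.ofReal (1 - t) • μ + ENNReal.ofReal t • ν

lemma isProbabilityMeasure_mixture {t : ℝ} (ht0 : 0 ≤ t) (ht1 : t ≤ 1) (μ ν : Measure X)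
    [IsProbabilityMeasure μ] [IsProbabilityMeasure ν] :
    IsProbabilityMeasure (mixture t μ ν) := by
  constructor
  simp only [mixture, Measure.add_apply, Measure.smul_apply, measure_univ, smul_eq_mul, mul_one]
  rw [← ENNReal.ofReal_add (by linarith) ht0]
  simp

/-- Integrated form of `add_mul_klGap`, densities being affine in the mixture. The additive form
avoids truncated subtraction in `ℝ≥0∞`. -/
lemma klDiv_mixture (μ ν m : Measure X) [IsFiniteMeasure μ] [IsFiniteMeasure ν]
    [IsFiniteMeasure m] (hμ : μ ≪ m) (hν : ν ≪ m) {t : ℝ} (ht0 : 0 < t) (ht1 : t ≤ 1) :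
    ENNReal.ofReal (1 - t) * klDiv μ m + ENNReal.ofReal t * klDiv ν m
      = klDiv (mixture t μ ν) m + ENNReal.ofReal t *
        ∫⁻ x, ENNReal.ofReal (klGap t (μ.rnDeriv m x).toReal (ν.rnDeriv m x).toReal) ∂m := by
  have hac : mixture t μ ν ≪ m := by
    rw [mixture]
    exact (hμ.smul_left _).add_left (hν.smul_left _)
  have : IsFiniteMeasure (mixture t μ ν) := by
    rw [mixture]
    have := Measure.smul_finite μ (c := ENNReal.ofReal (1 - t)) ENNReal.ofReal_ne_top
    have := Measure.smul_finite ν (c := ENNReal.ofReal t) ENNReal.ofReal_ne_top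
    infer_instance
  have hk := measurable_klFun
  have hg : Measurable fun x => klGap t (μ.rnDeriv m x).toReal (ν.rnDeriv m x).toReal :=
    (measurable_klGap t).comp (Measurable.prodMk (by fun_prop) (by fun_prop))
  rw [klDiv_eq_lintegral_klFun_of_ac hμ, klDiv_eq_lintegral_klFun_of_ac hν,
    klDiv_eq_lintegral_klFun_of_ac hac, ← lintegral_const_mul _ (by fun_prop),
    ← lintegral_const_mul _ (by fun_prop), ← lintegral_const_mul _ (by fun_prop),
    ← lintegral_add_left (by fun_prop), ← lintegral_add_left (by fun_prop)]
  have h1 : (mixture t μ ν).rnDeriv m =ᵐ[m]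
      fun x => ENNReal.ofReal (1 - t) * μ.rnDeriv m x + ENNReal.ofReal t * ν.rnDeriv m x := by
    rw [mixture]
    have := Measure.smul_finite μ (c := ENNReal.ofReal (1 - t)) ENNReal.ofReal_ne_top
    have := Measure.smul_finite ν (c := ENNReal.ofReal t) ENNReal.ofReal_ne_top
    filter_upwards [Measure.rnDeriv_add (ENNReal.ofReal (1 - t) • μ) (ENNReal.ofReal t • ν) m,
      Measure.rnDeriv_smul_left_of_ne_top μ m (r := ENNReal.ofReal (1 - t)) ENNReal.ofReal_ne_top,
      Measure.rnDeriv_smul_left_of_ne_top ν m (r := ENNReal.ofReal t) ENNReal.ofReal_ne_top]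
      with x h1 h2 h3
    rw [h1, Pi.add_apply, h2, h3]
    simp
  refine lintegral_congr_ae ?_
  filter_upwards [h1, μ.rnDeriv_ne_top m, ν.rnDeriv_ne_top m] with x hx hμx hνx
  have h2 : ((mixture t μ ν).rnDeriv m x).toReal
      = (1 - t) * (μ.rnDeriv m x).toReal + t * (ν.rnDeriv m x).toReal := by
    rw [hx, ENNReal.toReal_add (by finiteness) (by finiteness), ENNReal.toReal_mul,
      ENNReal.toReal_mul, ENNReal.toReal_ofReal (by linarith), ENNReal.toReal_ofReal ht0.le]
  have ha : 0 ≤ (μ.rnDeriv m x).toReal := ENNReal.toReal_nonneg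
  have hb : 0 ≤ (ν.rnDeriv m x).toReal := ENNReal.toReal_nonneg
  rw [h2]
  generalize (μ.rnDeriv m x).toReal = a at *
  generalize (ν.rnDeriv m x).toReal = b at *
  have ht1' : 0 ≤ 1 - t := by linarith
  have hab : 0 ≤ (1 - t) * a + t * b := by positivity
  rw [← ENNReal.ofReal_mul ht1', ← ENNReal.ofReal_mul ht0.le, ← ENNReal.ofReal_mul ht0.le,
    ← ENNReal.ofReal_add (mul_nonneg ht1' (klFun_nonneg ha)) (mul_nonneg ht0.le (klFun_nonneg hb)),
    ← ENNReal.ofReal_add (klFun_nonneg hab) (mul_nonneg ht0.le (klGap_nonneg ht0 ht1 ha hb)),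
    add_mul_klGap ht0.ne']

/-- Fatou's lemma as `t → 0`. The liminf of the gaps is a.e. finite, which first gives `ν ≪ μ`; it
is then the integrand of `KL(ν ‖ μ)` where the density of `μ` is positive. -/
lemma klDiv_le_of_lintegral_klGap_le (μ ν m : Measure X) [IsFiniteMeasure μ] [IsFiniteMeasure ν]
    [IsFiniteMeasure m] (hμ : μ ≪ m) (hν : ν ≪ m) (C : ℝ≥0∞)
    (h : ∀ t : ℝ, 0 < t → t ≤ 1 →
      ∫⁻ x, ENNReal.ofReal (klGap t (μ.rnDeriv m x).toReal (ν.rnDeriv m x).toReal) ∂m ≤ C) :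
    klDiv ν μ ≤ C := by
  rcases eq_or_ne C ⊤ with rfl | hC
  · exact le_top
  have hk := measurable_klFun
  have hg (t : ℝ) : Measurable fun x => klGap t (μ.rnDeriv m x).toReal (ν.rnDeriv m x).toReal :=
    (measurable_klGap t).comp (Measurable.prodMk (by fun_prop) (by fun_prop))
  obtain ⟨u, -, hu, hu0⟩ := exists_seq_strictAnti_tendsto' (zero_lt_one (α := ℝ))
  have hu' : Tendsto u atTop (𝓝[>] 0) :=
    tendsto_nhdsWithin_iff.2 ⟨hu0, Eventually.of_forall fun n => (hu n).1⟩
  set F : X → ℝ≥0∞ := fun x => liminf (fun n : ℕ => ENNReal.ofReal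
    (klGap (u n) (μ.rnDeriv m x).toReal (ν.rnDeriv m x).toReal)) atTop with hF
  have hFC : ∫⁻ x, F x ∂m ≤ C := by
    refine (lintegral_liminf_le fun n => (hg (u n)).ennreal_ofReal).trans ?_
    refine (liminf_le_liminf (v := fun _ => C) (Eventually.of_forall fun n =>
      h (u n) (hu n).1 (hu n).2.le)).trans ?_
    simp
  have hFm : Measurable F := Measurable.liminf fun n => (hg (u n)).ennreal_ofReal
  have hfin := ae_lt_top hFm (ne_top_of_le_ne_top hC hFC)
  have hzero : ∀ᵐ x ∂m, μ.rnDeriv m x = 0 → ν.rnDeriv m x = 0 := by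
    filter_upwards [hfin, ν.rnDeriv_ne_top m] with x hx hνx hx0
    by_contra hne
    have h1 := tendsto_klGap_zero (ENNReal.toReal_pos hne hνx)
    have h2 := (ENNReal.tendsto_ofReal_atTop.comp (h1.comp hu')).liminf_eq
    simp only [hF, hx0, ENNReal.toReal_zero] at hx
    exact absurd h2 hx.ne
  have hac : ν ≪ μ := by
    refine Measure.AbsolutelyContinuous.mk fun s hs h0 => ?_
    rw [← Measure.withDensity_rnDeriv_eq μ m hμ, withDensity_apply _ hs,
      lintegral_eq_zero_iff (by fun_prop)] at h0
    rw [← Measure.withDensity_rnDeriv_eq ν m hν, withDensity_apply _ hs,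
      lintegral_eq_zero_iff (by fun_prop)]
    filter_upwards [h0, ae_restrict_of_ae hzero] with x h1 h2 using h2 h1
  rw [klDiv_eq_lintegral_klFun_of_ac hac,
    ← lintegral_rnDeriv_mul hμ (f := fun x => ENNReal.ofReal (klFun (ν.rnDeriv μ x).toReal))
      (by fun_prop)]
  refine le_trans (lintegral_mono_ae ?_) hFC
  filter_upwards [Measure.rnDeriv_mul_rnDeriv (κ := m) hac, μ.rnDeriv_ne_top m] with x hx hμx
  rcases eq_or_ne (μ.rnDeriv m x) 0 with h0 | h0
  · simp [h0]
  have hpos := ENNReal.toReal_pos h0 hμx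
  have h1 := (ENNReal.tendsto_ofReal ((tendsto_klGap (y := (ν.rnDeriv m x).toReal)
    hpos).comp hu')).liminf_eq
  have h2 : (ν.rnDeriv μ x).toReal = (ν.rnDeriv m x).toReal / (μ.rnDeriv m x).toReal := by
    rw [← hx, Pi.mul_apply, ENNReal.toReal_mul]
    field_simp
  refine le_of_eq (Eq.trans ?_ h1.symm)
  rw [ENNReal.ofReal_mul hpos.le, ENNReal.ofReal_toReal hμx, h2]

/-- Entropic regularization of a convex functional is strongly convex with respect to the
Kullback-Leibler divergence: a minimizer `μ` over mixtures satisfies a three-point inequality. -/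
lemma add_klDiv_le_of_le_mixture (μ ν m : Measure X) [IsFiniteMeasure μ] [IsFiniteMeasure ν]
    [IsFiniteMeasure m] (Ψ : Measure X → ℝ≥0∞) (τ : ℝ) (hτ : 0 < τ)
    (hconv : ∀ t : ℝ, 0 < t → t ≤ 1 →
      Ψ (mixture t μ ν) ≤ ENNReal.ofReal (1 - t) * Ψ μ + ENNReal.ofReal t * Ψ ν)
    (hmin : ∀ t : ℝ, 0 < t → t ≤ 1 → Ψ μ + ENNReal.ofReal τ * klDiv μ m
      ≤ Ψ (mixture t μ ν) + ENNReal.ofReal τ * klDiv (mixture t μ ν) m) :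
    Ψ μ + ENNReal.ofReal τ * klDiv μ m + ENNReal.ofReal τ * klDiv ν μ
      ≤ Ψ ν + ENNReal.ofReal τ * klDiv ν m := by
  by_cases htop : Ψ ν + ENNReal.ofReal τ * klDiv ν m = ⊤
  · rw [htop]; exact le_top
  -- Minimality at `t = 1` compares `μ` with `ν` itself, so finiteness for `ν` passes to `μ`.
  have hone : mixture 1 μ ν = ν := by simp [mixture]
  have h1 := hmin 1 one_pos le_rfl
  rw [hone] at h1
  have hτ0 : ENNReal.ofReal τ ≠ 0 := by simpa using hτ
  obtain ⟨hΨν, hν'⟩ := ENNReal.add_ne_top.1 htop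
  have htop' := ne_top_of_le_ne_top htop h1
  obtain ⟨hΨμ, hμ'⟩ := ENNReal.add_ne_top.1 htop'
  have hνm : klDiv ν m ≠ ⊤ := fun h => hν' (by rw [h, ENNReal.mul_top hτ0])
  have hμm : klDiv μ m ≠ ⊤ := fun h => hμ' (by rw [h, ENNReal.mul_top hτ0])
  have hν : ν ≪ m := (klDiv_ne_top_iff.1 hνm).1
  have hμ : μ ≪ m := (klDiv_ne_top_iff.1 hμm).1
  have key : klDiv ν μ ≤ (Ψ ν + ENNReal.ofReal τ * klDiv ν m
      - (Ψ μ + ENNReal.ofReal τ * klDiv μ m)) / ENNReal.ofReal τ := by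
    refine klDiv_le_of_lintegral_klGap_le μ ν m hμ hν _ fun t ht0 ht1 => ?_
    rw [ENNReal.le_div_iff_mul_le (Or.inl hτ0) (Or.inl ENNReal.ofReal_ne_top)]
    refine ENNReal.le_sub_of_add_le_left htop' ?_
    set I := ∫⁻ x, ENNReal.ofReal (klGap t (μ.rnDeriv m x).toReal (ν.rnDeriv m x).toReal) ∂m
    have hmix := klDiv_mixture μ ν m hμ hν ht0 ht1
    have hT0 : ENNReal.ofReal t ≠ 0 := by simpa using ht0
    have hsum : ENNReal.ofReal (1 - t) + ENNReal.ofReal t = 1 := by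
      rw [← ENNReal.ofReal_add (by linarith) ht0.le]; simp
    have hS : ENNReal.ofReal (1 - t) ≠ ⊤ := ENNReal.ofReal_ne_top
    have hT : ENNReal.ofReal t ≠ ⊤ := ENNReal.ofReal_ne_top
    have h2 := hmin t ht0 ht1
    have h3 := hconv t ht0 ht1
    set S := ENNReal.ofReal (1 - t)
    set T := ENNReal.ofReal t
    set b := ENNReal.ofReal τ
    -- With `S + T = 1`, minimality and convexity are arranged so that the finite term `S * (Ψ μ + b
    -- * klDiv μ m)` cancels, and then the factor `T`, leaving a bound on `I` independent of `t`.
    have h4 : S * (Ψ μ + b * klDiv μ m) + T * (Ψ μ + b * klDiv μ m + I * b)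
        ≤ S * (Ψ μ + b * klDiv μ m) + T * (Ψ ν + b * klDiv ν m) := by
      calc S * (Ψ μ + b * klDiv μ m) + T * (Ψ μ + b * klDiv μ m + I * b)
          = (S + T) * (Ψ μ + b * klDiv μ m) + b * (T * I) := by ring
        _ ≤ (Ψ (mixture t μ ν) + b * klDiv (mixture t μ ν) m) + b * (T * I) := by
            rw [hsum, one_mul]; gcongr
        _ = Ψ (mixture t μ ν) + b * (klDiv (mixture t μ ν) m + T * I) := by ring
        _ ≤ (S * Ψ μ + T * Ψ ν) + b * (S * klDiv μ m + T * klDiv ν m) := by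
            rw [hmix]; gcongr
        _ = _ := by ring
    have h5 := (ENNReal.add_le_add_iff_left (ENNReal.mul_ne_top hS htop')).1 h4
    exact (ENNReal.mul_le_mul_iff_right hT0 hT).1 h5
  rw [ENNReal.le_div_iff_mul_le (Or.inl hτ0) (Or.inl ENNReal.ofReal_ne_top), mul_comm] at key
  calc _ ≤ (Ψ μ + ENNReal.ofReal τ * klDiv μ m) + _ := by gcongr
    _ = _ := add_tsub_cancel_of_le h1

/-- The kernel Radon–Nikodym derivative is jointly measurable, and absolute continuity holds on a
measurable set of states. -/
lemma measurable_klDiv_kernel {S : Type*} [MeasurableSpace S]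
    [MeasurableSpace.CountableOrCountablyGenerated S X] (π : Kernel S X) [IsFiniteKernel π]
    (m : Measure X) [IsFiniteMeasure m] : Measurable fun s => klDiv (π s) m := by
  classical
  have hk := measurable_klFun
  have h1 (s : S) : klDiv (π s) m = if π s ≪ m then
      ∫⁻ x, ENNReal.ofReal (klFun (π.rnDeriv (Kernel.const S m) s x).toReal) ∂m else ⊤ := by
    rw [klDiv_eq_lintegral_klFun]
    congr 1
    refine lintegral_congr_ae ?_
    have := Kernel.rnDeriv_eq_rnDeriv_measure (κ := π) (η := Kernel.const S m) (a := s)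
    rw [Kernel.const_apply] at this
    filter_upwards [this] with x hx
    rw [hx]
  simp_rw [h1]
  refine Measurable.ite ?_ ?_ measurable_const
  · exact Kernel.measurableSet_absolutelyContinuous π (Kernel.const S m)
  · have := Kernel.measurable_rnDeriv π (Kernel.const S m)
    refine Measurable.lintegral_prod_right' (f := fun p : S × X =>
      ENNReal.ofReal (klFun (π.rnDeriv (Kernel.const S m) p.1 p.2).toReal)) ?_
    fun_prop

end Measures

/-! ### Transport cost: symmetry and convexity along mixtures. -/

section Wasserstein

variable {d : ℕ}

lemma W2sq_le_lintegral {μ ν : Measure (ActionSpace d)}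
    {c : Measure (ActionSpace d × ActionSpace d)} (hc : IsCoupling μ ν c) :
    W2sq μ ν ≤ ∫⁻ z, ENNReal.ofReal (‖z.1 - z.2‖ ^ 2) ∂c :=
  iInf₂_le c hc

lemma W2sq_le_swap (μ ν : Measure (ActionSpace d)) : W2sq μ ν ≤ W2sq ν μ := by
  refine le_iInf₂ fun c hc => ?_
  have hswap : IsCoupling μ ν (c.map Prod.swap) := by
    constructor
    · rw [Measure.map_map measurable_fst measurable_swap]; exact hc.2
    · rw [Measure.map_map measurable_snd measurable_swap]; exact hc.1
  refine (W2sq_le_lintegral hswap).trans ?_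
  rw [lintegral_map (by fun_prop) measurable_swap]
  simp [norm_sub_rev]

lemma W2sq_comm (μ ν : Measure (ActionSpace d)) : W2sq μ ν = W2sq ν μ :=
  le_antisymm (W2sq_le_swap μ ν) (W2sq_le_swap ν μ)

lemma W2sq_self (μ : Measure (ActionSpace d)) : W2sq μ μ = 0 := by
  have hc : IsCoupling μ μ (μ.map fun x => (x, x)) := by
    have hm : Measurable fun x : ActionSpace d => (x, x) := by fun_prop
    constructor
    · rw [Measure.map_map measurable_fst hm]; exact Measure.map_id
    · rw [Measure.map_map measurable_snd hm]; exact Measure.map_id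
  have h := W2sq_le_lintegral hc
  rw [lintegral_map (by fun_prop) (by fun_prop)] at h
  simpa using h

lemma IsCoupling.mixture {μ ν ρ : Measure (ActionSpace d)}
    {c₁ c₂ : Measure (ActionSpace d × ActionSpace d)} (h₁ : IsCoupling μ ρ c₁)
    (h₂ : IsCoupling ν ρ c₂) {t : ℝ} (ht0 : 0 ≤ t) (ht1 : t ≤ 1) :
    IsCoupling (mixture t μ ν) ρ (_root_.mixture t c₁ c₂) := by
  constructor
  · rw [_root_.mixture, Measure.map_add _ _ measurable_fst, Measure.map_smul, Measure.map_smul,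
      h₁.1, h₂.1, _root_.mixture]
  · rw [_root_.mixture, Measure.map_add _ _ measurable_snd, Measure.map_smul, Measure.map_smul,
      h₁.2, h₂.2, ← add_smul, ← ENNReal.ofReal_add (by linarith) ht0]
    simp

/-- A mixture of couplings couples the mixture, and transport cost is linear in the coupling. -/
lemma W2sq_mixture_le (μ ν ρ : Measure (ActionSpace d)) {t : ℝ} (ht0 : 0 < t) (ht1 : t ≤ 1) :
    W2sq (mixture t μ ν) ρ
      ≤ ENNReal.ofReal (1 - t) * W2sq μ ρ + ENNReal.ofReal t * W2sq ν ρ := by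
  -- Pulling `1 - t` inside the infimum requires it to be nonzero.
  rcases ht1.eq_or_lt with rfl | ht1
  · simp [mixture]
  have h0 : ENNReal.ofReal t ≠ 0 := by simpa using ht0
  have h1 : ENNReal.ofReal (1 - t) ≠ 0 := by simpa using ht1
  simp only [W2sq.eq_1 μ, W2sq.eq_1 ν, iInf_subtype', ENNReal.mul_iInf_of_ne h0 ENNReal.ofReal_ne_top,
    ENNReal.mul_iInf_of_ne h1 ENNReal.ofReal_ne_top, ENNReal.iInf_add, ENNReal.add_iInf]
  refine le_iInf fun c₂ => le_iInf fun c₁ => ?_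
  refine (W2sq_le_lintegral (c₁.2.mixture c₂.2 ht0.le ht1.le)).trans ?_
  rw [mixture, lintegral_add_measure, lintegral_smul_measure, lintegral_smul_measure]
  rfl

lemma isP2_of_bounded {A : Set (ActionSpace d)} (hA : Bornology.IsBounded A)
    (μ : Measure (ActionSpace d)) [IsProbabilityMeasure μ] (hμ : μ Aᶜ = 0) : IsP2 μ := by
  refine ⟨inferInstance, ?_⟩
  obtain ⟨B, hB⟩ := hA.exists_norm_le
  calc _ ≤ ∫⁻ _, ENNReal.ofReal (B ^ 2) ∂μ := by
        refine lintegral_mono_ae ?_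
        have h1 : ∀ᵐ x ∂μ, x ∈ A := hμ
        filter_upwards [h1] with z hz
        gcongr
        exact hB z hz
    _ < ⊤ := by simp

end Wasserstein

/-! ### Extended integrals of an integrable function minus a nonnegative one. -/

section ExtIntegral

variable {X : Type*} [MeasurableSpace X]

lemma toENNReal_real_sub_add (b : ℝ) (g : ℝ≥0∞) :
    ((b : EReal) - (g : EReal)).toENNReal + ENNReal.ofReal (-b) + g
      = ENNReal.ofReal b + (-((b : EReal) - (g : EReal))).toENNReal := by
  induction g with
  | top => simp
  | coe g =>
    have h : ((g : ℝ≥0∞) : EReal) = ((g : ℝ) : EReal) := rfl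
    rw [h, ← EReal.coe_sub, ← EReal.coe_neg, EReal.real_coe_toENNReal, EReal.real_coe_toENNReal,
      ← ENNReal.ofReal_coe_nnreal]
    have hg := g.coe_nonneg
    generalize (g : ℝ) = x at *
    rw [← ENNReal.toReal_eq_toReal_iff' (by finiteness) (by finiteness),
      ENNReal.toReal_add (by finiteness) (by finiteness),
      ENNReal.toReal_add (by finiteness) (by finiteness),
      ENNReal.toReal_add (by finiteness) (by finiteness)]
    simp only [ENNReal.toReal_ofReal']
    grind

lemma lintegral_toENNReal_le (μ : Measure X) {f : X → EReal} {b : X → ℝ} {g : X → ℝ≥0∞}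
    (hf : f =ᵐ[μ] fun x => (b x : EReal) - (g x : EReal)) :
    ∫⁻ x, (f x).toENNReal ∂μ ≤ ∫⁻ x, ENNReal.ofReal (b x) ∂μ := by
  refine lintegral_mono_ae ?_
  filter_upwards [hf] with x hx
  rw [hx, ← EReal.real_coe_toENNReal]
  refine EReal.toENNReal_le_toENNReal ?_
  exact EReal.sub_le_of_le_add (le_add_of_nonneg_right (EReal.coe_ennreal_nonneg _))

lemma MeasureTheory.Integrable.lintegral_ofReal_ne_top {μ : Measure X} {b : X → ℝ}
    (hb : Integrable b μ) : ∫⁻ x, ENNReal.ofReal (b x) ∂μ ≠ ⊤ := by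
  refine ne_top_of_le_ne_top hb.2.ne (lintegral_mono fun x => ?_)
  exact Real.ofReal_le_enorm (b x)

/-- From `f = b - g` one gets `f⁺ + b⁻ + g = b⁺ + f⁻`, valid even where `g = ∞`. Integrating is safe
because `f⁺ ≤ b⁺` has finite integral; the result may be `-∞`. -/
lemma extIntegral_eq_integral_sub_lintegral (μ : Measure X) {f : X → EReal} {b : X → ℝ}
    {g : X → ℝ≥0∞} (hb : Integrable b μ) (hg : AEMeasurable g μ)
    (hf : f =ᵐ[μ] fun x => (b x : EReal) - (g x : EReal)) :
    extIntegral μ f = ((∫ x, b x ∂μ : ℝ) : EReal) - ((∫⁻ x, g x ∂μ : ℝ≥0∞) : EReal) := by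
  have hbm := hb.aestronglyMeasurable.aemeasurable
  have hfm : AEMeasurable f μ := by
    refine AEMeasurable.congr ?_ hf.symm
    simp only [sub_eq_add_neg]
    have h1 : AEMeasurable (fun x => (b x : EReal)) μ := hbm.coe_real_ereal
    have h2 : AEMeasurable (fun x => -(g x : EReal)) μ := hg.coe_ereal_ennreal.neg
    exact h1.add h2
  have hfin : ∫⁻ x, (f x).toENNReal ∂μ ≠ ⊤ :=
    ne_top_of_le_ne_top hb.lintegral_ofReal_ne_top (lintegral_toENNReal_le μ hf)
  have hfin1 := hb.lintegral_ofReal_ne_top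
  have hfin2 := hb.neg.lintegral_ofReal_ne_top
  have key : ∫⁻ x, (f x).toENNReal ∂μ + ∫⁻ x, ENNReal.ofReal (-b x) ∂μ + ∫⁻ x, g x ∂μ
      = ∫⁻ x, ENNReal.ofReal (b x) ∂μ + ∫⁻ x, (-f x).toENNReal ∂μ := by
    rw [← lintegral_add_left' hfm.ereal_toENNReal, ← lintegral_add_right' _ hg,
      ← lintegral_add_left' hbm.ennreal_ofReal]
    refine lintegral_congr_ae ?_
    filter_upwards [hf] with x hx
    rw [hx, toENNReal_real_sub_add]
  rw [integral_eq_lintegral_pos_part_sub_lintegral_neg_part hb, extIntegral]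
  simp only [Pi.neg_apply] at hfin2
  generalize ∫⁻ x, (f x).toENNReal ∂μ = F at *
  generalize ∫⁻ x, (-f x).toENNReal ∂μ = F' at *
  generalize ∫⁻ x, ENNReal.ofReal (b x) ∂μ = B at *
  generalize ∫⁻ x, ENNReal.ofReal (-b x) ∂μ = B' at *
  generalize ∫⁻ x, g x ∂μ = G at *
  lift F to NNReal using hfin
  lift B to NNReal using hfin1
  lift B' to NNReal using hfin2
  induction G with
  | top =>
    have : F' = ⊤ := by
      by_contra h
      lift F' to NNReal using h
      rw [add_top] at key
      exact absurd key.symm (by finiteness)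
    subst this
    simp
  | coe G =>
    have hF' : F' ≠ ⊤ := by
      rintro rfl
      rw [add_top] at key
      exact absurd key (by finiteness)
    lift F' to NNReal using hF'
    norm_cast at key
    have key' : (F : ℝ) + B' + G = B + F' := by exact_mod_cast key
    have h (x : NNReal) : ((x : ℝ≥0∞) : EReal) = ((x : ℝ) : EReal) := rfl
    simp only [h, ENNReal.coe_toReal]
    norm_cast
    linarith

lemma extIntegral_eq_lintegral_sub_integral (μ : Measure X) {f : X → EReal} {b : X → ℝ}
    {g : X → ℝ≥0∞} (hb : Integrable b μ) (hg : AEMeasurable g μ)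
    (hf : f =ᵐ[μ] fun x => (g x : EReal) - (b x : EReal)) :
    extIntegral μ f = ((∫⁻ x, g x ∂μ : ℝ≥0∞) : EReal) - ((∫ x, b x ∂μ : ℝ) : EReal) := by
  have hf' : (fun x => -f x) =ᵐ[μ] fun x => (b x : EReal) - (g x : EReal) := by
    filter_upwards [hf] with x hx
    rw [hx, EReal.neg_sub (by simp) (by simp), add_comm, sub_eq_add_neg]
  have h := extIntegral_eq_integral_sub_lintegral μ hb hg hf'
  have hfin : ∫⁻ x, (-f x).toENNReal ∂μ ≠ ⊤ :=
    ne_top_of_le_ne_top hb.lintegral_ofReal_ne_top (lintegral_toENNReal_le μ hf')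
  have h1 : extIntegral μ f = -extIntegral μ fun x => -f x := by
    simp only [extIntegral, neg_neg]
    rw [EReal.neg_sub (by simp) (by simpa using Or.inl hfin), add_comm, sub_eq_add_neg]
  rw [h1, h, EReal.neg_sub (by simp) (by simp), add_comm, sub_eq_add_neg]

end ExtIntegral

/-! ### Differential entropy as relative entropy. -/

section Entropy

variable {d : ℕ}

/-- On `A`, `p log p = klFun p - (1 - p)`, and the last term integrates to `vol A - 1`; off `A` the
density is a.e. zero. -/
lemma negEntropy_eq_klDiv_sub {A : Set (ActionSpace d)} (hA : MeasurableSet A)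
    (hAfin : volume A ≠ ⊤) (q : Measure (ActionSpace d)) [IsProbabilityMeasure q]
    (hq : q Aᶜ = 0) :
    negEntropy q = (klDiv q (volume.restrict A) : EReal)
      - ((volume.real A - 1 : ℝ) : EReal) := by
  have : IsFiniteMeasure (volume.restrict A : Measure (ActionSpace d)) :=
    ⟨by simpa using hAfin.lt_top⟩
  have hqA : q.restrict A = q := Measure.restrict_eq_self_of_ae_mem hq
  by_cases hac : q ≪ volume
  · have hac' : q ≪ volume.restrict A := by
      rw [← hqA]; exact hac.restrict A
    have hk := measurable_klFun
    have hp1 : q.rnDeriv volume =ᵐ[volume] A.indicator (q.rnDeriv volume) := by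
      have := Measure.rnDeriv_restrict q volume hA
      rwa [hqA] at this
    have hp2 : q.rnDeriv (volume.restrict A) =ᵐ[volume.restrict A] q.rnDeriv volume := by
      have h1 : q = (volume.restrict A).withDensity (q.rnDeriv volume) := by
        rw [← restrict_withDensity hA, Measure.withDensity_rnDeriv_eq _ _ hac, hqA]
      have h2 := Measure.rnDeriv_withDensity (volume.restrict A)
        (Measure.measurable_rnDeriv q volume)
      rwa [← h1] at h2
    have hint1 : Integrable (A.indicator fun _ => (1 : ℝ)) (volume : Measure (ActionSpace d)) :=
      (integrable_indicator_iff hA).2 (integrableOn_const hAfin)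
    have hint2 : Integrable (fun x => (q.rnDeriv volume x).toReal) volume :=
      Measure.integrable_toReal_rnDeriv
    rw [negEntropy, if_pos hac, extIntegral_eq_lintegral_sub_integral volume
      (b := fun x => A.indicator (fun _ => (1 : ℝ)) x - (q.rnDeriv volume x).toReal)
      (g := A.indicator fun x => ENNReal.ofReal (klFun (q.rnDeriv volume x).toReal))
      (hint1.sub hint2) (Measurable.indicator (by fun_prop) hA).aemeasurable]
    · rw [lintegral_indicator hA, integral_sub hint1 hint2, integral_indicator hA,
        Measure.integral_toReal_rnDeriv hac, klDiv_eq_lintegral_klFun_of_ac hac']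
      congr 2
      · refine lintegral_congr_ae ?_
        filter_upwards [hp2] with x hx
        rw [hx]
      · simp
    · filter_upwards [hp1] with x hx
      by_cases hxA : x ∈ A
      · simp only [hxA, indicator_of_mem]
        rw [EReal.coe_ennreal_ofReal, max_eq_left (klFun_nonneg ENNReal.toReal_nonneg), klFun]
        norm_cast
        ring
      · simp only [hxA, not_false_eq_true, indicator_of_notMem] at hx ⊢
        simp [hx]
  · have hac' : ¬ q ≪ volume.restrict A := fun h => hac (h.trans Measure.absolutelyContinuous_restrict)
    rw [negEntropy, if_neg hac, klDiv_of_not_ac hac', EReal.coe_ennreal_top, EReal.top_sub_coe]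

end Entropy

/-! ### Passage between extended-real values and nonnegative costs. -/

section ERealArithmetic

lemma exists_coe_ennreal_eq_coe {x : ℝ≥0∞} (hx : x ≠ ⊤) :
    ∃ y : ℝ, 0 ≤ y ∧ x = ENNReal.ofReal y :=
  ⟨x.toReal, ENNReal.toReal_nonneg, (ENNReal.ofReal_toReal hx).symm⟩

lemma coe_ennreal_ofReal_of_nonneg {y : ℝ} (hy : 0 ≤ y) :
    ((ENNReal.ofReal y : ℝ≥0∞) : EReal) = (y : EReal) := by
  rw [EReal.coe_ennreal_ofReal, max_eq_left hy]

lemma coe_sub_ennreal_le_iff (K : ℝ) (x y : ℝ≥0∞) :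
    (K : EReal) - (x : EReal) ≤ (K : EReal) - (y : EReal) ↔ y ≤ x := by
  by_cases hx : x = ⊤
  · simp [hx]
  by_cases hy : y = ⊤
  · subst hy
    refine iff_of_false (fun h => ?_) (by simpa using hx)
    obtain ⟨a, ha, rfl⟩ := exists_coe_ennreal_eq_coe hx
    rw [coe_ennreal_ofReal_of_nonneg ha, EReal.coe_ennreal_top, ← EReal.coe_sub, EReal.sub_top, le_bot_iff] at h
    exact EReal.coe_ne_bot _ h
  obtain ⟨a, ha, rfl⟩ := exists_coe_ennreal_eq_coe hx
  obtain ⟨b, hb, rfl⟩ := exists_coe_ennreal_eq_coe hy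
  rw [coe_ennreal_ofReal_of_nonneg ha, coe_ennreal_ofReal_of_nonneg hb]
  norm_cast
  rw [ENNReal.ofReal_le_ofReal_iff ha]
  constructor <;> intro h <;> linarith

lemma coe_add_mul_sub_ennreal {r R γ : ℝ} (hγ : 0 < γ) (hr : r ≤ R) (K : ℝ) (x : ℝ≥0∞) :
    (r : EReal) + (γ : EReal) * ((K : EReal) - (x : EReal))
      = ((R + γ * K : ℝ) : EReal)
        - ((ENNReal.ofReal (R - r) + ENNReal.ofReal γ * x : ℝ≥0∞) : EReal) := by
  by_cases hx : x = ⊤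
  · subst hx
    rw [ENNReal.mul_top (by simpa using hγ)]
    simp [EReal.coe_mul_bot_of_pos hγ]
  obtain ⟨a, ha, rfl⟩ := exists_coe_ennreal_eq_coe hx
  rw [← ENNReal.ofReal_mul hγ.le, ← ENNReal.ofReal_add (by linarith) (by positivity),
    coe_ennreal_ofReal_of_nonneg ha,
    coe_ennreal_ofReal_of_nonneg (add_nonneg (by linarith) (by positivity))]
  norm_cast
  ring

lemma coe_sub_mul_ennreal_sub {r R τ : ℝ} (hτ : 0 < τ) (hr : r ≤ R) (v : ℝ) (k : ℝ≥0∞) :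
    (r : EReal) - (τ : EReal) * ((k : EReal) - (v : EReal))
      = ((R + τ * v : ℝ) : EReal)
        - ((ENNReal.ofReal (R - r) + ENNReal.ofReal τ * k : ℝ≥0∞) : EReal) := by
  by_cases hk : k = ⊤
  · subst hk
    rw [ENNReal.mul_top (by simpa using hτ)]
    simp [EReal.coe_mul_top_of_pos hτ]
  obtain ⟨a, ha, rfl⟩ := exists_coe_ennreal_eq_coe hk
  rw [← ENNReal.ofReal_mul hτ.le, ← ENNReal.ofReal_add (by linarith) (by positivity),
    coe_ennreal_ofReal_of_nonneg ha,
    coe_ennreal_ofReal_of_nonneg (add_nonneg (by linarith) (by positivity))]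
  norm_cast
  ring

lemma coe_sub_sub_sub_ennreal {c τ : ℝ} (hc : 0 < c) (hτ : 0 < τ) (B v : ℝ) (G W k : ℝ≥0∞) :
    ((B : EReal) - (G : EReal)) - (c : EReal) * (W : EReal)
        - (τ : EReal) * ((k : EReal) - (v : EReal))
      = ((B + τ * v : ℝ) : EReal)
        - ((G + ENNReal.ofReal c * W + ENNReal.ofReal τ * k : ℝ≥0∞) : EReal) := by
  by_cases hG : G = ⊤
  · subst hG
    simp [sub_eq_add_neg]
  by_cases hW : W = ⊤
  · subst hW
    rw [ENNReal.mul_top (by simpa using hc), EReal.coe_ennreal_top, EReal.coe_mul_top_of_pos hc]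
    simp [sub_eq_add_neg]
  by_cases hk : k = ⊤
  · subst hk
    rw [ENNReal.mul_top (by simpa using hτ), EReal.coe_ennreal_top, EReal.top_sub_coe,
      EReal.coe_mul_top_of_pos hτ]
    simp [sub_eq_add_neg]
  obtain ⟨a, ha, rfl⟩ := exists_coe_ennreal_eq_coe hG
  obtain ⟨b, hb, rfl⟩ := exists_coe_ennreal_eq_coe hW
  obtain ⟨e, he, rfl⟩ := exists_coe_ennreal_eq_coe hk
  rw [← ENNReal.ofReal_mul hτ.le, ← ENNReal.ofReal_mul hc.le,
    ← ENNReal.ofReal_add ha (by positivity), ← ENNReal.ofReal_add (by positivity) (by positivity),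
    coe_ennreal_ofReal_of_nonneg ha, coe_ennreal_ofReal_of_nonneg hb,
    coe_ennreal_ofReal_of_nonneg he, coe_ennreal_ofReal_of_nonneg (by positivity)]
  norm_cast
  ring

lemma coe_sub_coe_sub_add_ennreal {a b c : ℝ} (hc : 0 < c) (hb : 0 ≤ b) (w D : ℝ≥0∞) :
    ((a : EReal) - ((ENNReal.ofReal b : ℝ≥0∞) : EReal)) - ((a : EReal) - (w : EReal))
        + (c : EReal) * (D : EReal)
      = ((w + ENNReal.ofReal c * D : ℝ≥0∞) : EReal) - (b : EReal) := by
  rw [coe_ennreal_ofReal_of_nonneg hb, EReal.coe_ennreal_add, EReal.coe_ennreal_mul,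
    coe_ennreal_ofReal_of_nonneg hc.le]
  by_cases hw : w = ⊤
  · subst hw
    have h1 : (c : EReal) * (D : EReal) ≠ ⊥ := by
      refine ne_bot_of_le_ne_bot EReal.zero_ne_bot (mul_nonneg ?_ (EReal.coe_ennreal_nonneg _))
      exact_mod_cast hc.le
    rw [EReal.coe_ennreal_top, EReal.top_add_of_ne_bot h1, EReal.top_sub_coe, EReal.sub_top,
      ← EReal.coe_sub, EReal.coe_sub_bot, EReal.top_add_of_ne_bot h1]
  by_cases hD : D = ⊤
  · subst hD
    obtain ⟨x, hx, rfl⟩ := exists_coe_ennreal_eq_coe hw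
    rw [coe_ennreal_ofReal_of_nonneg hx, EReal.coe_ennreal_top, EReal.coe_mul_top_of_pos hc,
      EReal.coe_add_top, EReal.top_sub_coe]
    norm_cast
  obtain ⟨x, hx, rfl⟩ := exists_coe_ennreal_eq_coe hw
  obtain ⟨y, hy, rfl⟩ := exists_coe_ennreal_eq_coe hD
  rw [coe_ennreal_ofReal_of_nonneg hx, coe_ennreal_ofReal_of_nonneg hy]
  norm_cast
  ring

lemma coe_ennreal_sub_le_mul {γ b : ℝ} (hγ0 : 0 < γ) (hγ1 : γ < 1) (hb : 0 ≤ b) {x y : ℝ≥0∞}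
    (h : y ≤ ENNReal.ofReal (1 - γ) * ENNReal.ofReal b + ENNReal.ofReal γ * x) :
    (y : EReal) - (b : EReal) ≤ (γ : EReal) * ((x : EReal) - (b : EReal)) := by
  by_cases hx : x = ⊤
  · subst hx
    simp [EReal.coe_mul_top_of_pos hγ0]
  obtain ⟨u, hu, rfl⟩ := exists_coe_ennreal_eq_coe hx
  have h1 : 0 ≤ 1 - γ := by linarith
  rw [← ENNReal.ofReal_mul h1, ← ENNReal.ofReal_mul hγ0.le,
    ← ENNReal.ofReal_add (by positivity) (by positivity)] at h
  obtain ⟨v, hv, rfl⟩ := exists_coe_ennreal_eq_coe (ne_top_of_le_ne_top ENNReal.ofReal_ne_top h)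
  rw [ENNReal.ofReal_le_ofReal_iff (by positivity)] at h
  rw [coe_ennreal_ofReal_of_nonneg hu, coe_ennreal_ofReal_of_nonneg hv]
  norm_cast
  linarith

end ERealArithmetic

/-! ### Costs and the Bellman equation. -/

namespace MDP

variable {S : Type*} [MeasurableSpace S] {d : ℕ}

lemma IsPolicy.isMarkovKernel {M : MDP S d} {π : Kernel S (ActionSpace d)} (hπ : M.IsPolicy π) :
    IsMarkovKernel π :=
  ⟨fun s => (hπ s).isProbabilityMeasure⟩

instance (M : MDP S d) : IsMarkovKernel M.trans := M.isMarkovKernel_trans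

instance (M : MDP S d) (π : Kernel S (ActionSpace d)) [IsMarkovKernel π] :
    IsMarkovKernel (M.stepKernel π) := by
  unfold stepKernel; infer_instance

instance (M : MDP S d) (π : Kernel S (ActionSpace d)) [IsMarkovKernel π] (t : ℕ) :
    IsMarkovKernel (M.stateKernel π t) := by
  induction t with
  | zero => unfold stateKernel; infer_instance
  | succ t ih => unfold stateKernel; infer_instance

lemma lintegral_stepKernel (M : MDP S d) (π : Kernel S (ActionSpace d)) [IsMarkovKernel π]
    {f : S → ℝ≥0∞} (hf : Measurable f) (s : S) :
    ∫⁻ y, f y ∂(M.stepKernel π s) = ∫⁻ a, ∫⁻ y, f y ∂(M.trans (s, a)) ∂(π s) := by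
  rw [stepKernel, Kernel.lintegral_comp _ _ _ hf, Kernel.lintegral_id_prod hf.lintegral_kernel]

/-- The definition peels off the last step; the Bellman equation conditions on the first. -/
lemma stateKernel_succ' (M : MDP S d) (π : Kernel S (ActionSpace d)) [IsMarkovKernel π] (t : ℕ) :
    M.stateKernel π (t + 1) = M.stateKernel π t ∘ₖ M.stepKernel π := by
  induction t with
  | zero => simp [stateKernel]
  | succ t ih =>
    rw [stateKernel, ih, ← Kernel.comp_assoc]
    change M.stateKernel π (t + 1) ∘ₖ _ = _
    rw [ih]

/-- The action space with Lebesgue measure. -/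
noncomputable abbrev baseMeasure (M : MDP S d) : Measure (ActionSpace d) :=
  volume.restrict M.actions

/-- The expected one-step cost: the deficit of the reward with respect to the upper bound `R`,
plus the relative entropy with respect to Lebesgue measure on the action space. -/
noncomputable def stageCost (M : MDP S d) (R τ : ℝ) (π : Kernel S (ActionSpace d)) (s : S) :
    ℝ≥0∞ :=
  ∫⁻ a, ENNReal.ofReal (R - M.reward s a) ∂(π s)
    + ENNReal.ofReal τ * klDiv (π s) M.baseMeasure

/-- The discounted expected total cost. -/
noncomputable def costToGo (M : MDP S d) (R τ : ℝ) (π : Kernel S (ActionSpace d)) (s : S) :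
    ℝ≥0∞ :=
  ∑' t : ℕ, ENNReal.ofReal (M.disc ^ t) * ∫⁻ x, M.stageCost R τ π x ∂(M.stateKernel π t s)

/-- The cost counterpart of `softQ`. -/
noncomputable def actionCost (M : MDP S d) (R τ : ℝ) (π : Kernel S (ActionSpace d)) (s : S)
    (a : ActionSpace d) : ℝ≥0∞ :=
  ENNReal.ofReal (R - M.reward s a)
    + ENNReal.ofReal M.disc * ∫⁻ y, M.costToGo R τ π y ∂(M.trans (s, a))

/-- The constant relating values to costs: `value = valueBound - costToGo`. -/
noncomputable def valueBound (M : MDP S d) (R τ : ℝ) : ℝ :=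
  (R + τ * (volume.real M.actions - 1)) / (1 - M.disc)

section Cost

variable (M : MDP S d) (R τ : ℝ) (π : Kernel S (ActionSpace d))

lemma tsum_ofReal_disc_pow :
    ∑' t : ℕ, ENNReal.ofReal (M.disc ^ t) = ENNReal.ofReal (1 / (1 - M.disc)) := by
  rw [← ENNReal.ofReal_tsum_of_nonneg (fun t => pow_nonneg M.disc_pos.le t)
    (summable_geometric_of_lt_one M.disc_pos.le M.disc_lt_one),
    tsum_geometric_of_lt_one M.disc_pos.le M.disc_lt_one, one_div]

lemma tendsto_sum_costToGo (s : S) :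
    Tendsto (fun n => ∑ t ∈ Finset.range n,
      ENNReal.ofReal (M.disc ^ t) * ∫⁻ x, M.stageCost R τ π x ∂(M.stateKernel π t s))
      atTop (𝓝 (M.costToGo R τ π s)) :=
  ENNReal.summable.hasSum.tendsto_sum_nat

lemma measurable_rewardCost :
    Measurable fun p : S × ActionSpace d => ENNReal.ofReal (R - M.reward p.1 p.2) := by
  have := M.measurable_reward
  exact (measurable_const.sub this).ennreal_ofReal

lemma measurable_rewardCost_right (s : S) :
    Measurable fun a : ActionSpace d => ENNReal.ofReal (R - M.reward s a) :=
  (M.measurable_rewardCost R).comp measurable_prodMk_left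

variable [IsMarkovKernel π]

lemma occupation_univ (s : S) :
    M.occupation π s univ = ENNReal.ofReal (1 / (1 - M.disc)) := by
  rw [← tsum_ofReal_disc_pow]
  simp [occupation, Measure.sum_apply]

lemma costToGo_le_of_stageCost_le {c : ℝ≥0∞}
    (h : ∀ s, M.stageCost R τ π s ≤ c) (s : S) :
    M.costToGo R τ π s ≤ ENNReal.ofReal (1 / (1 - M.disc)) * c := by
  calc _ ≤ ∑' t : ℕ, ENNReal.ofReal (M.disc ^ t) * c := by
        refine ENNReal.tsum_le_tsum fun t => ?_
        gcongr
        calc _ ≤ ∫⁻ _, c ∂(M.stateKernel π t s) := lintegral_mono h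
          _ = c := by simp
    _ = _ := by rw [ENNReal.tsum_mul_right, tsum_ofReal_disc_pow]

variable [IsFiniteMeasure M.baseMeasure]

lemma measurable_stageCost : Measurable (M.stageCost R τ π) := by
  have h1 : Measurable fun s => ∫⁻ a, ENNReal.ofReal (R - M.reward s a) ∂(π s) :=
    (M.measurable_rewardCost R).lintegral_kernel_prod_right'
  exact h1.add ((measurable_klDiv_kernel π M.baseMeasure).const_mul _)

lemma measurable_costToGo : Measurable (M.costToGo R τ π) :=
  Measurable.tsum fun _ =>
    ((M.measurable_stageCost R τ π).lintegral_kernel).const_mul _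

lemma measurable_actionCost :
    Measurable fun p : S × ActionSpace d => M.actionCost R τ π p.1 p.2 :=
  (M.measurable_rewardCost R).add
    (((M.measurable_costToGo R τ π).lintegral_kernel (κ := M.trans)).const_mul _)

lemma measurable_actionCost_right (s : S) : Measurable (M.actionCost R τ π s) :=
  (M.measurable_actionCost R τ π).comp measurable_prodMk_left

/-- Finite-horizon costs. -/
lemma sum_range_succ_costToGo (s : S) (n : ℕ) :
    ∑ t ∈ Finset.range (n + 1),
        ENNReal.ofReal (M.disc ^ t) * ∫⁻ x, M.stageCost R τ π x ∂(M.stateKernel π t s)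
      = M.stageCost R τ π s + ENNReal.ofReal M.disc * ∫⁻ y, ∑ t ∈ Finset.range n,
        ENNReal.ofReal (M.disc ^ t) * ∫⁻ x, M.stageCost R τ π x ∂(M.stateKernel π t y)
          ∂(M.stepKernel π s) := by
  have hm := M.measurable_stageCost R τ π
  rw [Finset.sum_range_succ', add_comm, lintegral_finsetSum _ fun t _ =>
    (hm.lintegral_kernel).const_mul _, Finset.mul_sum]
  congr 1
  · simp [stateKernel, Kernel.id_apply, lintegral_dirac' _ hm]
  · refine Finset.sum_congr rfl fun t _ => ?_
    rw [lintegral_const_mul _ hm.lintegral_kernel, stateKernel_succ',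
      Kernel.lintegral_comp _ _ _ hm, pow_succ', ENNReal.ofReal_mul M.disc_pos.le, mul_assoc]

/-- The Bellman equation. -/
lemma costToGo_eq (s : S) :
    M.costToGo R τ π s = M.stageCost R τ π s
      + ENNReal.ofReal M.disc * ∫⁻ y, M.costToGo R τ π y ∂(M.stepKernel π s) := by
  have hm := M.measurable_stageCost R τ π
  have h : ∫⁻ y, M.costToGo R τ π y ∂(M.stepKernel π s) = ∑' t : ℕ, ENNReal.ofReal (M.disc ^ t)
      * ∫⁻ x, M.stageCost R τ π x ∂(M.stateKernel π (t + 1) s) := by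
    unfold costToGo
    rw [lintegral_tsum fun t => ((hm.lintegral_kernel).const_mul _).aemeasurable]
    refine tsum_congr fun t => ?_
    rw [lintegral_const_mul _ hm.lintegral_kernel, stateKernel_succ',
      Kernel.lintegral_comp _ _ _ hm]
  rw [h, costToGo, tsum_eq_zero_add' ENNReal.summable, ← ENNReal.tsum_mul_left]
  congr 1
  · simp [stateKernel, Kernel.id_apply, lintegral_dirac' _ hm]
  · refine tsum_congr fun t => ?_
    rw [pow_succ', ENNReal.ofReal_mul M.disc_pos.le, mul_assoc]

/-- A supersolution of the Bellman equation dominates one Bellman step below the cost. -/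
lemma costToGo_le_of_supersolution {W : S → ℝ≥0∞}
    (hW : ∀ s, M.stageCost R τ π s
      + ENNReal.ofReal M.disc * ∫⁻ y, W y ∂(M.stepKernel π s) ≤ W s) (s : S) :
    M.costToGo R τ π s
      ≤ M.stageCost R τ π s + ENNReal.ofReal M.disc * ∫⁻ y, W y ∂(M.stepKernel π s) := by
  have hle (n : ℕ) : ∀ s, ∑ t ∈ Finset.range n, ENNReal.ofReal (M.disc ^ t)
      * ∫⁻ x, M.stageCost R τ π x ∂(M.stateKernel π t s) ≤ W s := by
    induction n with
    | zero => simp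
    | succ n ih =>
      intro s
      rw [sum_range_succ_costToGo]
      refine le_trans ?_ (hW s)
      gcongr with y
      exact ih y
  -- The shift by one matters: an `(n + 1)`-term sum is one Bellman step applied to an `n`-term sum,
  -- which is at most `W`. The plain limit would only give the bound `W s`.
  refine le_of_tendsto ((tendsto_add_atTop_iff_nat 1).2 (M.tendsto_sum_costToGo R τ π s))
    (Eventually.of_forall fun n => ?_)
  simp only [sum_range_succ_costToGo]
  gcongr with y
  exact hle n y

lemma lintegral_occupation (s : S) :
    ∫⁻ x, (ENNReal.ofReal (R - M.reward x.1 x.2)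
      + ENNReal.ofReal τ * klDiv (π x.1) M.baseMeasure) ∂(M.occupation π s)
      = M.costToGo R τ π s := by
  have hk := (measurable_klDiv_kernel π M.baseMeasure).const_mul (ENNReal.ofReal τ)
  have hc : Measurable fun x : S × ActionSpace d => ENNReal.ofReal (R - M.reward x.1 x.2)
      + ENNReal.ofReal τ * klDiv (π x.1) M.baseMeasure :=
    (M.measurable_rewardCost R).add (hk.comp measurable_fst)
  rw [occupation, lintegral_sum_measure, costToGo]
  refine tsum_congr fun t => ?_
  rw [lintegral_smul_measure, smul_eq_mul, Measure.lintegral_compProd hc]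
  congr 1
  refine lintegral_congr fun x => ?_
  rw [lintegral_add_left (M.measurable_rewardCost_right R x), stageCost]
  simp

end Cost

/-! ### Values and proximal objectives in terms of costs. -/

section Value

variable {M : MDP S d} {R τ : ℝ} {π : Kernel S (ActionSpace d)}

/-- The reward bound is assumed only on the actions, so `ENNReal.ofReal (R - r)` is known to be an
untruncated deficit only there. -/
lemma ae_occupation_mem_actions (hπ : M.IsPolicy π) (s : S) :
    ∀ᵐ x ∂(M.occupation π s), x.2 ∈ M.actions := by
  have := hπ.isMarkovKernel
  rw [occupation, ae_iff, Measure.sum_apply]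
  · simp only [Measure.smul_apply, ENNReal.tsum_eq_zero]
    intro t
    have h : ∀ᵐ x ∂(M.stateKernel π t s ⊗ₘ π), x.2 ∈ M.actions :=
      Measure.ae_compProd_of_ae_ae (measurable_snd M.measurableSet_actions)
        (Eventually.of_forall fun y => (hπ y).compl_null)
    rw [ae_iff] at h
    simp [h]
  · exact (measurable_snd M.measurableSet_actions).compl

lemma value_eq (hπ : M.IsPolicy π) (hA : volume M.actions ≠ ⊤) (hτ : 0 < τ)
    (hR : ∀ s, ∀ a ∈ M.actions, M.reward s a ≤ R) (s : S) :
    M.value τ π s = (M.valueBound R τ : EReal) - (M.costToGo R τ π s : EReal) := by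
  have := hπ.isMarkovKernel
  have hfin : IsFiniteMeasure M.baseMeasure := ⟨by simpa using hA.lt_top⟩
  have hocc : IsFiniteMeasure (M.occupation π s) := ⟨by simp [occupation_univ]⟩
  have hγ : 0 < 1 - M.disc := sub_pos.2 M.disc_lt_one
  have hk := (measurable_klDiv_kernel π M.baseMeasure).const_mul (ENNReal.ofReal τ)
  have hc : Measurable fun x : S × ActionSpace d => ENNReal.ofReal (R - M.reward x.1 x.2)
      + ENNReal.ofReal τ * klDiv (π x.1) M.baseMeasure :=
    (M.measurable_rewardCost R).add (hk.comp measurable_fst)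
  have hae : (fun x : S × ActionSpace d =>
      (M.reward x.1 x.2 : EReal) - (τ : EReal) * negEntropy (π x.1)) =ᵐ[M.occupation π s]
      fun x => ((R + τ * (volume.real M.actions - 1) : ℝ) : EReal)
        - ((ENNReal.ofReal (R - M.reward x.1 x.2)
          + ENNReal.ofReal τ * klDiv (π x.1) M.baseMeasure : ℝ≥0∞) : EReal) := by
    filter_upwards [ae_occupation_mem_actions hπ s] with x hx
    have := (hπ x.1).isProbabilityMeasure
    rw [negEntropy_eq_klDiv_sub M.measurableSet_actions hA _ (hπ x.1).compl_null,
      coe_sub_mul_ennreal_sub hτ (hR _ _ hx)]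
  rw [value, extIntegral_eq_integral_sub_lintegral _ (integrable_const _) hc.aemeasurable hae,
    lintegral_occupation, integral_const, valueBound, measureReal_def, occupation_univ,
    ENNReal.toReal_ofReal (by positivity), smul_eq_mul, one_div, div_eq_inv_mul]

lemma extIntegral_value (hπ : M.IsPolicy π) (hA : volume M.actions ≠ ⊤) (hτ : 0 < τ)
    (hR : ∀ s, ∀ a ∈ M.actions, M.reward s a ≤ R) (ν : Measure S) [IsProbabilityMeasure ν] :
    extIntegral ν (M.value τ π)
      = (M.valueBound R τ : EReal) - ((∫⁻ s, M.costToGo R τ π s ∂ν : ℝ≥0∞) : EReal) := by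
  have := hπ.isMarkovKernel
  have hfin : IsFiniteMeasure M.baseMeasure := ⟨by simpa using hA.lt_top⟩
  rw [extIntegral_eq_integral_sub_lintegral ν (b := fun _ => M.valueBound R τ)
    (g := M.costToGo R τ π) (integrable_const _) (M.measurable_costToGo R τ π).aemeasurable
    (Eventually.of_forall fun s => value_eq hπ hA hτ hR s)]
  simp

lemma extIntegral_softQ (hπ : M.IsPolicy π) (hA : volume M.actions ≠ ⊤) (hτ : 0 < τ)
    (hR : ∀ s, ∀ a ∈ M.actions, M.reward s a ≤ R) (s : S) {q : Measure (ActionSpace d)}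
    (hq : M.IsActionLaw q) :
    extIntegral q (M.softQ τ π s) = ((R + M.disc * M.valueBound R τ : ℝ) : EReal)
      - ((∫⁻ a, M.actionCost R τ π s a ∂q : ℝ≥0∞) : EReal) := by
  have := hπ.isMarkovKernel
  have := hq.isProbabilityMeasure
  have hfin : IsFiniteMeasure M.baseMeasure := ⟨by simpa using hA.lt_top⟩
  rw [extIntegral_eq_integral_sub_lintegral q (b := fun _ => R + M.disc * M.valueBound R τ)
    (g := M.actionCost R τ π s) (integrable_const _)
    (M.measurable_actionCost_right R τ π s).aemeasurable]
  · simp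
  · have h : ∀ᵐ a ∂q, a ∈ M.actions := hq.compl_null
    filter_upwards [h] with a ha
    rw [softQ, extIntegral_value hπ hA hτ hR, coe_add_mul_sub_ennreal M.disc_pos (hR s a ha),
      actionCost]

lemma proxObjective_eq (hπ : M.IsPolicy π) (hA : volume M.actions ≠ ⊤) (hτ : 0 < τ)
    (hR : ∀ s, ∀ a ∈ M.actions, M.reward s a ≤ R) (s : S) {q : Measure (ActionSpace d)}
    (hq : M.IsActionLaw q) {η : ℝ} (hη : 0 < η) :
    M.proxObjective τ η π s q = (M.valueBound R τ : EReal)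
      - ((∫⁻ a, M.actionCost R τ π s a ∂q + ENNReal.ofReal (1 / (2 * η)) * W2sq q (π s)
        + ENNReal.ofReal τ * klDiv q M.baseMeasure : ℝ≥0∞) : EReal) := by
  have := hq.isProbabilityMeasure
  have hγ : 1 - M.disc ≠ 0 := (sub_pos.2 M.disc_lt_one).ne'
  rw [proxObjective, extIntegral_softQ hπ hA hτ hR s hq,
    negEntropy_eq_klDiv_sub M.measurableSet_actions hA _ hq.compl_null,
    coe_sub_sub_sub_ennreal (by positivity) hτ]
  -- The constants agree because `valueBound` is the fixed point of `v = R + γ v + τ (vol A - 1)`.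
  congr 2
  rw [valueBound]
  field_simp
  ring

/-- Up to the transport penalty, the proximal objective at `ρ` is the Bellman operator of `ρ`
applied to the cost of `π`. -/
lemma lintegral_actionCost [IsMarkovKernel π] [IsFiniteMeasure M.baseMeasure]
    (ρ : Kernel S (ActionSpace d)) [IsMarkovKernel ρ] (s : S) :
    ∫⁻ a, M.actionCost R τ π s a ∂(ρ s) + ENNReal.ofReal τ * klDiv (ρ s) M.baseMeasure
      = M.stageCost R τ ρ s
        + ENNReal.ofReal M.disc * ∫⁻ y, M.costToGo R τ π y ∂(M.stepKernel ρ s) := by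
  have hW := M.measurable_costToGo R τ π
  have hm : Measurable fun a => ∫⁻ y, M.costToGo R τ π y ∂(M.trans (s, a)) :=
    (hW.lintegral_kernel (κ := M.trans)).comp measurable_prodMk_left
  simp only [actionCost]
  rw [lintegral_add_left (M.measurable_rewardCost_right R s), lintegral_const_mul _ hm,
    lintegral_stepKernel M ρ hW, stageCost]
  ring

end Value

/-! ### One proximal step. -/

section Improvement

variable {M : MDP S d} {R τ : ℝ} {π π' : Kernel S (ActionSpace d)}

lemma IsActionLaw.mixture {q q' : Measure (ActionSpace d)} (hq : M.IsActionLaw q)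
    (hq' : M.IsActionLaw q') {t : ℝ} (ht0 : 0 ≤ t) (ht1 : t ≤ 1) :
    M.IsActionLaw (mixture t q q') := by
  have := hq.isProbabilityMeasure
  have := hq'.isProbabilityMeasure
  refine ⟨isProbabilityMeasure_mixture ht0 ht1 q q', ?_⟩
  simp [_root_.mixture, hq.compl_null, hq'.compl_null]

/-- The three-point inequality for one proximal step. -/
lemma proximal_three_point (hπ : M.IsPolicy π) (hA : volume M.actions ≠ ⊤) (hτ : 0 < τ)
    (hR : ∀ s, ∀ a ∈ M.actions, M.reward s a ≤ R) {η : ℝ} (hη : 0 < η) (s : S)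
    {p q : Measure (ActionSpace d)} (hp : M.IsActionLaw p) (hq : M.IsActionLaw q)
    (hmax : IsMaxOn (M.proxObjective τ η π s) {q | M.IsActionLaw q} p) :
    ∫⁻ a, M.actionCost R τ π s a ∂p + ENNReal.ofReal (1 / (2 * η)) * W2sq p (π s)
        + ENNReal.ofReal τ * klDiv p M.baseMeasure + ENNReal.ofReal τ * klDiv q p
      ≤ ∫⁻ a, M.actionCost R τ π s a ∂q + ENNReal.ofReal (1 / (2 * η)) * W2sq q (π s)
        + ENNReal.ofReal τ * klDiv q M.baseMeasure := by
  have := hp.isProbabilityMeasure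
  have := hq.isProbabilityMeasure
  have hfin : IsFiniteMeasure M.baseMeasure := ⟨by simpa using hA.lt_top⟩
  refine add_klDiv_le_of_le_mixture p q M.baseMeasure (fun q =>
    ∫⁻ a, M.actionCost R τ π s a ∂q + ENNReal.ofReal (1 / (2 * η)) * W2sq q (π s)) τ hτ
    (fun t ht0 ht1 => ?_) fun t ht0 ht1 => ?_
  · have hlin : ∫⁻ a, M.actionCost R τ π s a ∂(mixture t p q)
        = ENNReal.ofReal (1 - t) * ∫⁻ a, M.actionCost R τ π s a ∂p
          + ENNReal.ofReal t * ∫⁻ a, M.actionCost R τ π s a ∂q := by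
      rw [mixture, lintegral_add_measure, lintegral_smul_measure, lintegral_smul_measure]
      rfl
    have hW := W2sq_mixture_le p q (π s) ht0 ht1
    calc _ ≤ (ENNReal.ofReal (1 - t) * ∫⁻ a, M.actionCost R τ π s a ∂p
          + ENNReal.ofReal t * ∫⁻ a, M.actionCost R τ π s a ∂q)
          + ENNReal.ofReal (1 / (2 * η)) * (ENNReal.ofReal (1 - t) * W2sq p (π s)
            + ENNReal.ofReal t * W2sq q (π s)) := by
          rw [hlin]; gcongr
      _ = _ := by ring
  · have hmem := hp.mixture hq ht0.le ht1
    have h := hmax hmem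
    simp only [mem_ofPred_eq] at h
    rwa [proxObjective_eq hπ hA hτ hR s hmem hη, proxObjective_eq hπ hA hτ hR s hp hη,
      coe_sub_ennreal_le_iff] at h

/-- One proximal step, compared with an arbitrary policy `ρ`. -/
lemma costToGo_add_W2sq_le (hπ : M.IsPolicy π) (hπ' : M.IsPolicy π')
    (hAbdd : Bornology.IsBounded M.actions) (hτ : 0 < τ)
    (hR : ∀ s, ∀ a ∈ M.actions, M.reward s a ≤ R) {lam : ℝ} (hlam : 0 < lam)
    (hmax : ∀ s, IsMaxOn (M.proxObjective τ (1 / (M.disc * lam * τ)) π s)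
      {q | M.IsActionLaw q} (π' s))
    (hT2 : ∀ s, SatisfiesT2 lam (π' s)) {ρ : Kernel S (ActionSpace d)} (hρ : M.IsPolicy ρ)
    (s : S) :
    M.costToGo R τ π' s + ENNReal.ofReal (lam * τ) * (2⁻¹ * W2sq (π' s) (ρ s))
      ≤ M.stageCost R τ ρ s
        + ENNReal.ofReal M.disc * ∫⁻ y, M.costToGo R τ π y ∂(M.stepKernel ρ s)
        + ENNReal.ofReal M.disc * (ENNReal.ofReal (lam * τ) * (2⁻¹ * W2sq (π s) (ρ s))) := by
  have := hπ.isMarkovKernel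
  have := hπ'.isMarkovKernel
  have := hρ.isMarkovKernel
  have hA : volume M.actions ≠ ⊤ := hAbdd.measure_lt_top.ne
  have hfin : IsFiniteMeasure M.baseMeasure := ⟨by simpa using hA.lt_top⟩
  have hγ := M.disc_pos
  have hη : 0 < 1 / (M.disc * lam * τ) := by positivity
  -- The step size is chosen for this identity: the penalty weight is `γ` times the weight of the
  -- distance in the Lyapunov quantity.
  have hcoef : ENNReal.ofReal (1 / (2 * (1 / (M.disc * lam * τ))))
      = ENNReal.ofReal M.disc * (ENNReal.ofReal (lam * τ) * 2⁻¹) := by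
    have : (2⁻¹ : ℝ≥0∞) = ENNReal.ofReal 2⁻¹ := by
      rw [ENNReal.ofReal_inv_of_pos two_pos]; simp
    rw [this, ← ENNReal.ofReal_mul (by positivity), ← ENNReal.ofReal_mul hγ.le]
    congr 1
    field_simp
  have hstep (ρ : Kernel S (ActionSpace d)) (hρ : M.IsPolicy ρ) (s : S) :
      M.stageCost R τ π' s + ENNReal.ofReal M.disc * ∫⁻ y, M.costToGo R τ π y ∂(M.stepKernel π' s)
        + ENNReal.ofReal τ * klDiv (ρ s) (π' s)
        ≤ M.stageCost R τ ρ s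
          + ENNReal.ofReal M.disc * ∫⁻ y, M.costToGo R τ π y ∂(M.stepKernel ρ s)
          + ENNReal.ofReal M.disc * (ENNReal.ofReal (lam * τ) * (2⁻¹ * W2sq (π s) (ρ s))) := by
    have := hρ.isMarkovKernel
    have h := proximal_three_point hπ hA hτ hR hη s (hπ' s) (hρ s) (hmax s)
    rw [hcoef, W2sq_comm (ρ s)] at h
    rw [← lintegral_actionCost, ← lintegral_actionCost]
    -- The nonnegative penalty of the new iterate itself is discarded.
    calc _ ≤ _ := by
          gcongr
          exact le_self_add
      _ ≤ _ := h
      _ = _ := by ring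
  -- Policy improvement: against the old policy the penalty vanishes, so its cost is a supersolution
  -- for the new policy.
  have himp : M.costToGo R τ π' s ≤ M.stageCost R τ π' s
      + ENNReal.ofReal M.disc * ∫⁻ y, M.costToGo R τ π y ∂(M.stepKernel π' s) := by
    refine M.costToGo_le_of_supersolution R τ π' (fun s => ?_) s
    have h := hstep π hπ s
    rw [W2sq_self, mul_zero, mul_zero, mul_zero, add_zero, ← costToGo_eq] at h
    exact le_self_add.trans h
  refine le_trans (add_le_add himp ?_) (hstep ρ hρ s)
  have := (hρ s).isProbabilityMeasure
  -- `T₂` converts the leftover divergence into distance; the constants match since `λτ · ½ · (2 /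
  -- λ) = τ`.
  have hT := (hT2 s).le_kl (ρ s) (isP2_of_bounded hAbdd _ (hρ s).compl_null)
  rw [W2sq_comm]
  calc _ ≤ ENNReal.ofReal (lam * τ) * (2⁻¹ * (ENNReal.ofReal (2 / lam) * klDiv (ρ s) (π' s))) := by
        gcongr
    _ = (ENNReal.ofReal (lam * τ) * (2⁻¹ * ENNReal.ofReal (2 / lam))) * klDiv (ρ s) (π' s) := by
        ring
    _ = _ := by
        congr 1
        have : (2⁻¹ : ℝ≥0∞) = ENNReal.ofReal 2⁻¹ := by
          rw [ENNReal.ofReal_inv_of_pos two_pos]; simp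
        rw [this, ← ENNReal.ofReal_mul (by positivity), ← ENNReal.ofReal_mul (by positivity)]
        congr 1
        field_simp

end Improvement

end MDP

/-! ### Stationarity, finiteness of the optimal cost, and contraction. -/

namespace MDP

variable {S : Type*} [MeasurableSpace S] {d : ℕ} {M : MDP S d} {R τ : ℝ}
  {π π' : Kernel S (ActionSpace d)}

lemma isActionLaw_cond (hA : volume M.actions ≠ ⊤) (hA0 : volume M.actions ≠ 0) :
    M.IsActionLaw (cond volume M.actions) := by
  refine ⟨cond_isProbabilityMeasure_of_finite hA0 hA, ?_⟩
  rw [cond_apply M.measurableSet_actions]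
  simp

lemma klDiv_cond_ne_top (hA : volume M.actions ≠ ⊤) (hA0 : volume M.actions ≠ 0) :
    klDiv (cond volume M.actions) M.baseMeasure ≠ ⊤ := by
  have hfin : IsFiniteMeasure M.baseMeasure := ⟨by simpa using hA.lt_top⟩
  have := (isActionLaw_cond hA hA0).isProbabilityMeasure
  have hc : (volume M.actions)⁻¹ ≠ ⊤ := ENNReal.inv_ne_top.2 hA0
  have hac : cond volume M.actions ≪ M.baseMeasure := by
    rw [ProbabilityTheory.cond]
    exact Measure.smul_absolutelyContinuous
  have hae : ∀ᵐ x ∂M.baseMeasure,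
      ENNReal.ofReal (klFun ((cond volume M.actions).rnDeriv M.baseMeasure x).toReal)
        = ENNReal.ofReal (klFun (volume M.actions)⁻¹.toReal) := by
    filter_upwards [Measure.rnDeriv_smul_left_of_ne_top M.baseMeasure M.baseMeasure hc,
      Measure.rnDeriv_self M.baseMeasure] with x h1 h2
    rw [ProbabilityTheory.cond, h1, Pi.smul_apply, h2]
    simp
  rw [klDiv_eq_lintegral_klFun_of_ac hac, lintegral_congr_ae hae, lintegral_const]
  finiteness

/-- The optimal cost is bounded, by comparison with the uniform policy. -/
lemma IsOptimal.exists_costToGo_le {Rmin : ℝ} (hopt : M.IsOptimal τ π)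
    (hA : volume M.actions ≠ ⊤) (hA0 : volume M.actions ≠ 0) (hτ : 0 < τ)
    (hR : ∀ s, ∀ a ∈ M.actions, M.reward s a ∈ Set.Icc Rmin R) :
    ∃ c : ℝ≥0∞, c ≠ ⊤ ∧ ∀ s, M.costToGo R τ π s ≤ c := by
  have hR' : ∀ s, ∀ a ∈ M.actions, M.reward s a ≤ R := fun s a ha => (hR s a ha).2
  have hlaw := isActionLaw_cond hA hA0
  have := hlaw.isProbabilityMeasure
  have hpol : M.IsPolicy (Kernel.const S (cond volume M.actions)) := fun _ => hlaw
  have hκ := klDiv_cond_ne_top hA hA0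
  refine ⟨ENNReal.ofReal (1 / (1 - M.disc)) * (ENNReal.ofReal (R - Rmin)
    + ENNReal.ofReal τ * klDiv (cond volume M.actions) M.baseMeasure), by finiteness,
    fun s => ?_⟩
  have h := hopt.le_value _ hpol s
  rw [value_eq hpol hA hτ hR', value_eq hopt.isPolicy hA hτ hR', coe_sub_ennreal_le_iff] at h
  refine h.trans (M.costToGo_le_of_stageCost_le R τ _ (fun s => ?_) s)
  rw [stageCost, Kernel.const_apply]
  gcongr
  calc _ ≤ ∫⁻ _, ENNReal.ofReal (R - Rmin) ∂(cond volume M.actions) := by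
        refine lintegral_mono_ae ?_
        have h : ∀ᵐ a ∂(cond volume M.actions), a ∈ M.actions := hlaw.compl_null
        filter_upwards [h] with a ha
        have := (hR s a ha).1
        gcongr
    _ = _ := by simp

lemma lintegral_stepKernel_of_invariant {ν : Measure S} (hν : Kernel.Invariant (M.stepKernel π) ν)
    {f : S → ℝ≥0∞} (hf : Measurable f) :
    ∫⁻ s, ∫⁻ y, f y ∂(M.stepKernel π s) ∂ν = ∫⁻ s, f s ∂ν := by
  rw [← Measure.lintegral_bind (Kernel.aemeasurable _) hf.aemeasurable, hν.def]

/-- Integrate the Bellman equation against the invariant law; finiteness permits cancelling `γ ∫ C`.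
-/
lemma lintegral_stageCost_of_invariant [IsMarkovKernel π] [IsFiniteMeasure M.baseMeasure]
    {ν : Measure S} (hν : Kernel.Invariant (M.stepKernel π) ν)
    (hfin : ∫⁻ s, M.costToGo R τ π s ∂ν ≠ ⊤) :
    ∫⁻ s, M.stageCost R τ π s ∂ν
      = ENNReal.ofReal (1 - M.disc) * ∫⁻ s, M.costToGo R τ π s ∂ν := by
  have hW := M.measurable_costToGo R τ π
  have h : ∫⁻ s, M.costToGo R τ π s ∂ν = ∫⁻ s, M.stageCost R τ π s ∂ν
      + ENNReal.ofReal M.disc * ∫⁻ s, M.costToGo R τ π s ∂ν := by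
    conv_lhs => rw [lintegral_congr fun s => M.costToGo_eq R τ π s,
      lintegral_add_left (M.measurable_stageCost R τ π),
      lintegral_const_mul _ hW.lintegral_kernel, lintegral_stepKernel_of_invariant hν hW]
  have hγ : 0 ≤ 1 - M.disc := by linarith [M.disc_lt_one]
  have hsum : ENNReal.ofReal (1 - M.disc) + ENNReal.ofReal M.disc = 1 := by
    rw [← ENNReal.ofReal_add hγ M.disc_pos.le]; simp
  generalize ∫⁻ s, M.costToGo R τ π s ∂ν = w at *
  have h2 : w = ENNReal.ofReal (1 - M.disc) * w + ENNReal.ofReal M.disc * w := by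
    rw [← add_mul, hsum, one_mul]
  exact (ENNReal.add_left_inj (ENNReal.mul_ne_top ENNReal.ofReal_ne_top hfin)).1 (h.symm.trans h2)

/-- The two value constants cancel. Finiteness of the optimal cost makes the subtracted term real,
so an infinite cost of `π` gives `+∞`. -/
lemma lyapunov_eq {πstar : Kernel S (ActionSpace d)} (hπ : M.IsPolicy π)
    (hπstar : M.IsPolicy πstar) (hA : volume M.actions ≠ ⊤) (hτ : 0 < τ)
    (hR : ∀ s, ∀ a ∈ M.actions, M.reward s a ≤ R) {lam : ℝ} (hlam : 0 < lam)
    (ν : Measure S) [IsProbabilityMeasure ν] (hfin : ∫⁻ s, M.costToGo R τ πstar s ∂ν ≠ ⊤) :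
    M.lyapunov τ lam ν πstar π
      = ((∫⁻ s, M.costToGo R τ π s ∂ν
          + ENNReal.ofReal (lam * τ) * policyDist ν π πstar : ℝ≥0∞) : EReal)
        - (((∫⁻ s, M.costToGo R τ πstar s ∂ν).toReal : ℝ) : EReal) := by
  rw [← coe_sub_coe_sub_add_ennreal (a := M.valueBound R τ) (by positivity)
    ENNReal.toReal_nonneg, ENNReal.ofReal_toReal hfin, lyapunov, perf, perf,
    extIntegral_value hπ hA hτ hR, extIntegral_value hπstar hA hτ hR]

/-- One-step contraction of the Lyapunov quantity. -/
lemma lyapunov_le_mul {πstar : Kernel S (ActionSpace d)} (hπ : M.IsPolicy π)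
    (hπ' : M.IsPolicy π') (hπstar : M.IsPolicy πstar) (hAbdd : Bornology.IsBounded M.actions)
    (hτ : 0 < τ) (hR : ∀ s, ∀ a ∈ M.actions, M.reward s a ≤ R) {lam : ℝ} (hlam : 0 < lam)
    (hmax : ∀ s, IsMaxOn (M.proxObjective τ (1 / (M.disc * lam * τ)) π s)
      {q | M.IsActionLaw q} (π' s))
    (hT2 : ∀ s, SatisfiesT2 lam (π' s)) (ν : Measure S) [IsProbabilityMeasure ν]
    (hν : Kernel.Invariant (M.stepKernel πstar) ν)
    (hfin : ∫⁻ s, M.costToGo R τ πstar s ∂ν ≠ ⊤) :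
    M.lyapunov τ lam ν πstar π' ≤ (M.disc : EReal) * M.lyapunov τ lam ν πstar π := by
  have := hπ.isMarkovKernel
  have := hπ'.isMarkovKernel
  have := hπstar.isMarkovKernel
  have hA : volume M.actions ≠ ⊤ := hAbdd.measure_lt_top.ne
  have : IsFiniteMeasure M.baseMeasure := ⟨by simpa using hA.lt_top⟩
  have hW := M.measurable_costToGo R τ π
  have hm : Measurable fun s => M.stageCost R τ πstar s
      + ENNReal.ofReal M.disc * ∫⁻ y, M.costToGo R τ π y ∂(M.stepKernel πstar s) :=
    (M.measurable_stageCost R τ πstar).add (hW.lintegral_kernel.const_mul _)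
  rw [lyapunov_eq hπ' hπstar hA hτ hR hlam ν hfin, lyapunov_eq hπ hπstar hA hτ hR hlam ν hfin]
  refine coe_ennreal_sub_le_mul M.disc_pos M.disc_lt_one ENNReal.toReal_nonneg ?_
  rw [ENNReal.ofReal_toReal hfin, ← lintegral_stageCost_of_invariant hν hfin, policyDist,
    policyDist, ← lintegral_const_mul' _ _ ENNReal.ofReal_ne_top,
    ← lintegral_const_mul' _ _ ENNReal.ofReal_ne_top, mul_add,
    ← lintegral_const_mul' (ENNReal.ofReal M.disc) (fun s => _ * _) ENNReal.ofReal_ne_top,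
    ← lintegral_stepKernel_of_invariant hν hW, ← add_assoc,
    ← lintegral_const_mul _ hW.lintegral_kernel,
    ← lintegral_add_left (M.measurable_stageCost R τ πstar),
    ← lintegral_add_left hm]
  -- Measurability of the distance in the state is never needed: lower integrals are superadditive
  -- on the left, and on the right each sum was split using its measurable summand.
  refine (le_lintegral_add _ _).trans (lintegral_mono fun s => ?_)
  exact costToGo_add_W2sq_le hπ hπ' hAbdd hτ hR hlam hmax hT2 hπstar s

lemma pow_mul_le_of_log_div_le {γ l ε : ℝ} (hγ0 : 0 < γ) (hγ1 : γ < 1) (hl : 0 ≤ l) (hε : 0 < ε) {k : ℕ}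
    (hk : 1 / (1 - γ) * Real.log (l / ε) ≤ k) : γ ^ k * l ≤ ε := by
  -- At `l = 0` the convention `Real.log 0 = 0` makes the threshold zero, so every `k` qualifies.
  rcases hl.eq_or_lt with rfl | hl
  · simpa using hε.le
  have h1 : 0 < 1 - γ := by linarith
  have h2 : Real.log (l / ε) ≤ (1 - γ) * k := by
    rw [one_div, inv_mul_le_iff₀ h1] at hk
    exact hk
  -- This yields `γ ^ k ≤ exp (-(1 - γ) k)`, the source of the factor `1 / (1 - γ)`.
  have h3 : Real.log γ ≤ -(1 - γ) := by linarith [Real.log_le_sub_one_of_pos hγ0]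
  rw [← Real.log_le_log_iff (by positivity) hε, Real.log_mul (by positivity) hl.ne', Real.log_pow]
  rw [Real.log_div hl.ne' hε.ne'] at h2
  nlinarith [mul_le_mul_of_nonneg_left h3 (Nat.cast_nonneg (α := ℝ) k)]

end MDP

theorem theorem1 {S : Type*} [MeasurableSpace S] {d : ℕ} (M : MDP S d)
    -- bounded action space of positive volume, bounded reward
    (hA_bdd : Bornology.IsBounded M.actions) (hA_pos : volume M.actions ≠ 0)
    (Rmin Rmax : ℝ) (hr : ∀ s, ∀ a ∈ M.actions, M.reward s a ∈ Set.Icc Rmin Rmax)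
    (τ : ℝ) (hτ : 0 < τ)
    -- an optimal policy and a stationary distribution of it
    (πstar : Kernel S (ActionSpace d)) (hπstar : M.IsOptimal τ πstar)
    (νstar : Measure S) [IsProbabilityMeasure νstar]
    (hνstar : Kernel.Invariant (M.stepKernel πstar) νstar)
    -- the iterates, with the prescribed step size, satisfy `T₂` uniformly
    (lam : ℝ) (hlam : 0 < lam) (π : ℕ → Kernel S (ActionSpace d))
    (hπ : M.IsWPPG τ (1 / (M.disc * lam * τ)) π)
    (hT2 : ∀ k s, SatisfiesT2 lam (π k s)) :
    (∀ k, M.lyapunov τ lam νstar πstar (π (k + 1))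
        ≤ (M.disc : EReal) * M.lyapunov τ lam νstar πstar (π k)) ∧
    (∀ k, M.lyapunov τ lam νstar πstar (π k)
        ≤ ((M.disc ^ k : ℝ) : EReal) * M.lyapunov τ lam νstar πstar (π 0)) ∧
    (M.lyapunov τ lam νstar πstar (π 0) ≠ ⊤ →
      ∀ ε : ℝ, 0 < ε → ∀ k : ℕ,
        1 / (1 - M.disc)
            * Real.log ((M.lyapunov τ lam νstar πstar (π 0)).toReal / ε) ≤ (k : ℝ) →
          M.lyapunov τ lam νstar πstar (π k) ≤ (ε : EReal)) := by
  have hA : volume M.actions ≠ ⊤ := hA_bdd.measure_lt_top.ne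
  have hR : ∀ s, ∀ a ∈ M.actions, M.reward s a ≤ Rmax := fun s a ha => (hr s a ha).2
  have hfin : ∫⁻ s, M.costToGo Rmax τ πstar s ∂νstar ≠ ⊤ := by
    obtain ⟨c, hc, hle⟩ := hπstar.exists_costToGo_le hA hA_pos hτ hr
    refine ne_top_of_le_ne_top hc ((lintegral_mono hle).trans ?_)
    simp
  have hstep : ∀ k, M.lyapunov τ lam νstar πstar (π (k + 1))
      ≤ (M.disc : EReal) * M.lyapunov τ lam νstar πstar (π k) := fun k =>
    MDP.lyapunov_le_mul (hπ.isPolicy k) (hπ.isPolicy (k + 1)) hπstar.isPolicy hA_bdd hτ hR hlam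
      (hπ.isMax k) (hT2 (k + 1)) νstar hνstar hfin
  have hpow : ∀ k, M.lyapunov τ lam νstar πstar (π k)
      ≤ ((M.disc ^ k : ℝ) : EReal) * M.lyapunov τ lam νstar πstar (π 0) := by
    intro k
    induction k with
    | zero => simp
    | succ k ih =>
      refine (hstep k).trans ?_
      rw [pow_succ', EReal.coe_mul, mul_assoc]
      exact mul_le_mul_of_nonneg_left ih (by exact_mod_cast M.disc_pos.le)
  refine ⟨hstep, hpow, fun htop ε hε k hk => (hpow k).trans ?_⟩
  have heq := MDP.lyapunov_eq (hπ.isPolicy 0) hπstar.isPolicy hA hτ hR hlam νstar hfin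
  -- Optimality makes the initial Lyapunov quantity nonnegative, as the logarithmic estimate
  -- requires.
  have hle : ∫⁻ s, M.costToGo Rmax τ πstar s ∂νstar ≤ ∫⁻ s, M.costToGo Rmax τ (π 0) s ∂νstar
      + ENNReal.ofReal (lam * τ) * policyDist νstar (π 0) πstar := by
    refine le_trans (lintegral_mono fun s => ?_) le_self_add
    have h := hπstar.le_value _ (hπ.isPolicy 0) s
    rwa [MDP.value_eq (hπ.isPolicy 0) hA hτ hR, MDP.value_eq hπstar.isPolicy hA hτ hR,
      coe_sub_ennreal_le_iff] at h
  generalize M.lyapunov τ lam νstar πstar (π 0) = L at *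
  generalize ∫⁻ s, M.costToGo Rmax τ (π 0) s ∂νstar
      + ENNReal.ofReal (lam * τ) * policyDist νstar (π 0) πstar = X at *
  generalize ∫⁻ s, M.costToGo Rmax τ πstar s ∂νstar = w at *
  have hX : X ≠ ⊤ := by
    rintro rfl
    exact htop (by rw [heq]; simp)
  obtain ⟨x, hx, rfl⟩ := exists_coe_ennreal_eq_coe hX
  obtain ⟨b, hb, rfl⟩ := exists_coe_ennreal_eq_coe hfin
  rw [ENNReal.ofReal_le_ofReal_iff hx] at hle
  rw [coe_ennreal_ofReal_of_nonneg hx, ENNReal.toReal_ofReal hb, ← EReal.coe_sub] at heq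
  rw [heq, EReal.toReal_coe] at hk
  rw [heq]
  exact_mod_cast MDP.pow_mul_le_of_log_div_le M.disc_pos M.disc_lt_one (sub_nonneg.2 hle) hε hk
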